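/- **Setting.** Let $F:\mathbb{R}^n\times\mathbb{R}^d\to\mathbb{R}$ be measurable and twice differentiable in its first argument $\theta$, let $x$ be a random vector in $\mathbb{R}^d$ with distribution $D$, and let $f(\theta)=\mathbb{E}_x[F(\theta,x)]$ (assumed to exist for every $\theta$). At each iteration $t=1,2,\dots$ a batch $b_t$ of $m_t\ge 1$ samples is drawn, all samples of all batches being independent with distribution $D$, and $f^t(\theta)=\frac1{m_t}\sum_{x\in b_t}F(\theta,x)$. *Base optimizer.* BaseOpt is a first-order optimizer with a diagonal preconditioner: at iteration $t$ it has a diagonal preconditioner $\mathrm{diag}(p_t)$, where $p_t\in\mathbb{R}^n$ is a measurable function of the vectors $g_2$ (below) passed to it in the iterations before $t$; with $q_t=1/p_t$ (entrywise) and step size $\eta_t$ its step on the input $g_2$ is $d_b=-\eta_t\,\mathrm{diag}(q_t)g_2$. *ESE.* For integers $k,\ell\ge 0$ with $k+\ell\le n$ and a symmetric $A\in\mathbb{R}^{n\times n}$, ESE runs $m=\min\{n,\max\{4(k+\ell),\lceil 2\ln n\rceil\}\}$ Lanczos iterations with full orthogonalization on $A$, with any starting vector (and any restart after a breakdown), which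 gives $U\in\mathbb{R}^{n\times m}$ with orthonormal columns and a symmetric tridiagonal $T_A\in\mathbb{R}^{m\times m}$; with an eigendecomposition $T_A=Q\Lambda Q^T$, $\Lambda$ sorted from largest to smallest, it returns the vector $\widehat\lambda$ of the first $k$ and last $\ell$ diagonal entries of $\Lambda$ and the matrix $\widehat V$ of the corresponding columns of $UQ$. The choices made in it depend measurably on $A$. *FOSI.* Fix $\theta_1\in\mathbb{R}^n$, integers $T\ge1$ and $W\ge 1$, and a damping constant $\delta>0$; initially $u=0$, $\widehat V=0$. Iteration $t=1,2,\dots$ is: 1. if $t-1\ge W$ and $T$ divides $t-1-W$, call ESE on $\nabla^2 f^{i}(\theta_t)$ for a predefined index $i=i(t)<t$, and set $u=1/|\widehat\lambda|$ entrywise, where $\delta$ is first added to the entries of $|\widehat\lambda|$ smaller than $\delta$; 2. $g=\nabla f^t(\theta_t)$, $g_1=\widehat V\widehat V^Tg$, $g_2=g-g_1$, $d_1=-\eta_t\widehat V\big((\widehat V^Tg_1)\odot u\big)$, $d_b=-\eta_t\,\mathrm{diag}(q_t)g_2$, $d_2=d_b-\widehat V\widehat V^Td_b$, and $\theta_{t+1}=\theta_t+d_1+d_2$;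 that is, both learning rates of FOSI equal the step size $\eta_t$, and the preconditioner used at iteration $t$ depends only on $b_1,\dots,b_{t-1}$. **Lemma 3.** Let $\beta\in(0.5,1)$ and $c>0$ be constants, let $\eta_t=c\,t^{-\beta}$, and assume: 1. $f$ is $L$-smooth (differentiable with $L$-Lipschitz gradient) and $f\ge f^{\mathrm{low}}$ for a real number $f^{\mathrm{low}}$. 2. For every iteration $t$, almost surely $\mathbb{E}_{x}[\nabla_\theta F(\theta_t,x)]=\nabla f(\theta_t)$ and $\mathbb{E}_{x}[\|\nabla_\theta F(\theta_t,x)-\nabla f(\theta_t)\|^2]\le\sigma^2$, where $\sigma>0$ and the expectation is over $x\sim D$ with $\theta_t$ held fixed. 3. There are constants $z,\rho>0$ such that $\|\nabla^2_\theta F(\theta,x)\|\le z$ (spectral norm) for all $\theta,x$, and, almost surely, at every iteration all diagonal entries of BaseOpt's preconditioner lie in $[\rho,z]$. Then $\mathbb{E}[\|\nabla f(\theta_t)\|^2]<\infty$ for all $t$, and for given $\epsilon\in(0,1)$ the number of iterations $N$ needed to obtain $$\frac1N\sum_{t=1}^N\mathbb{E}\big[\|\nabla f(\theta_t)\|^2\big]\le\epsilon$$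 is $N=O\big(\epsilon^{-1/(1-\beta)}\big)$: there is a constant $C>0$, depending only on $L,\sigma,z,\rho,\delta,c,\beta$ and an upper bound $\Delta$ on $f(\theta_1)-f^{\mathrm{low}}$, such that for every $\epsilon\in(0,1)$ the inequality holds for all integers $N\ge C\,\epsilon^{-1/(1-\beta)}$. -/

import Mathlib

open MeasureTheory ProbabilityTheory
open scoped Gradient NNReal ENNReal

noncomputable section

/-- `ℝⁿ` with the Euclidean norm. -/
abbrev Vec (n : ℕ) : Type := EuclideanSpace ℝ (Fin n)

/-- `V̂ V̂ᵀ g`. -/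
def colProj {n : ℕ} {κ : Type} [Fintype κ] (V : Matrix (Fin n) κ ℝ) (g : Vec n) : Vec n :=
  WithLp.toLp 2 (V.mulVec (V.transpose.mulVec g.ofLp))

/-- The Hessian of `g` at `θ`, as an operator on `ℝⁿ` (its norm is the spectral norm). -/
def hessian {n : ℕ} (g : Vec n → ℝ) (θ : Vec n) : Vec n →L[ℝ] Vec n :=
  fderiv ℝ (gradient g) θ

/-- The Hessian of `g` at `θ`, as a matrix in the standard basis. -/
def hessianMatrix {n : ℕ} (g : Vec n → ℝ) (θ : Vec n) : Matrix (Fin n) (Fin n) ℝ :=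
  fun i j => hessian g θ (EuclideanSpace.single j 1) i

/-- `L`-smoothness: `g` is differentiable and its gradient is `L`-Lipschitz. -/
def LSmooth {n : ℕ} (L : ℝ≥0) (g : Vec n → ℝ) : Prop :=
  Differentiable ℝ g ∧ LipschitzWith L (gradient g)

/-! ### Extreme spectrum estimation (ESE) -/

/-- The number `m = max {4 (k + ℓ), 2 ln n}` of Lanczos iterations (at most `n` orthonormal Lanczos
vectors exist). -/
def lanczosSteps (n k l : ℕ) : ℕ :=
  min n (max (4 * (k + l)) ⌈2 * Real.log n⌉₊)

/-- `U`, `T` is a possible output of `m` Lanczos iterations (in exact arithmetic, with full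
orthogonalization) on the symmetric matrix `A`: `U` has orthonormal columns `u₀, …, u_{m-1}`,
`T` is symmetric tridiagonal, and the three-term recurrence
`A u_j = T_{j-1,j} u_{j-1} + T_{j,j} u_j + T_{j+1,j} u_{j+1}` holds for `j < m - 1`, while for
`j = m - 1` it holds up to a residual orthogonal to all the `u_i`. The starting vector `u₀` is
arbitrary, and so is the vector with which the iteration is restarted after a breakdown
(`T_{j+1,j} = 0`). -/
structure IsLanczosOutput {n m : ℕ} (A : Matrix (Fin n) (Fin n) ℝ)
    (U : Matrix (Fin n) (Fin m) ℝ) (T : Matrix (Fin m) (Fin m) ℝ) : Prop where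
  orthonormal : U.transpose * U = 1
  symm : T.IsSymm
  tridiagonal : ∀ i j : Fin m, (i : ℕ) + 1 < j → T i j = 0
  recurrence : ∀ (a : Fin n) (j : Fin m), (j : ℕ) + 1 < m → (A * U) a j = (U * T) a j
  residual : U.transpose * (A * U - U * T) = 0

/-- `lam`, `V` is a possible output `λ̂`, `V̂` of ESE on the symmetric matrix `A`: with
`U`, `T` from Lanczos and `T = Q Λ Qᵀ` an eigendecomposition, `Λ` sorted from largest to smallest,
`λ̂` consists of the first `k` and the last `ℓ` entries of `Λ`, and `V̂` of the corresponding
columns of `U Q`. -/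
def IsESEOutput {n k l : ℕ} (A : Matrix (Fin n) (Fin n) ℝ)
    (lam : Fin k ⊕ Fin l → ℝ) (V : Matrix (Fin n) (Fin k ⊕ Fin l) ℝ) : Prop :=
  ∃ (U : Matrix (Fin n) (Fin (lanczosSteps n k l)) ℝ)
    (T Q : Matrix (Fin (lanczosSteps n k l)) (Fin (lanczosSteps n k l)) ℝ)
    (Λ : Fin (lanczosSteps n k l) → ℝ),
    IsLanczosOutput A U T ∧
    Q.transpose * Q = 1 ∧ T = Q * Matrix.diagonal Λ * Q.transpose ∧ Antitone Λ ∧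
    (∀ i : Fin k, ∃ r : Fin (lanczosSteps n k l), (r : ℕ) = i ∧
      lam (Sum.inl i) = Λ r ∧ ∀ a, V a (Sum.inl i) = (U * Q) a r) ∧
    (∀ j : Fin l, ∃ r : Fin (lanczosSteps n k l), (r : ℕ) + l = lanczosSteps n k l + j ∧
      lam (Sum.inr j) = Λ r ∧ ∀ a, V a (Sum.inr j) = (U * Q) a r)

/-- An implementation of the ESE procedure: a choice of starting vectors and of
eigendecompositions, depending measurably on the matrix. -/
structure ESE (n k l : ℕ) where
  /-- `λ̂` as a function of the Hessian -/
  eigval : (Fin n → Fin n → ℝ) → (Fin k ⊕ Fin l → ℝ)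
  /-- `V̂` as a function of the Hessian -/
  eigvec : (Fin n → Fin n → ℝ) → (Fin n → Fin k ⊕ Fin l → ℝ)
  measurable_eigval : Measurable eigval
  measurable_eigvec : Measurable eigvec
  isOutput : ∀ A : Matrix (Fin n) (Fin n) ℝ, A.IsSymm →
    IsESEOutput A (eigval A) (Matrix.of (eigvec A))

/-! ### The base optimizer -/

/-- A first-order optimizer with a diagonal preconditioner: the diagonal of the preconditioner at
iteration `t` is a measurable function of the `t` gradients that the optimizer has received in the
iterations `0, …, t - 1`. -/
structure BaseOpt (n : ℕ) where
  /-- the diagonal of the preconditioner -/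
  prec : (t : ℕ) → (Fin t → Vec n) → (Fin n → ℝ)
  measurable_prec : ∀ t, Measurable (prec t)

/-- BaseOptStep: `d_b = -η diag(q) g₂`, where `q` is the entrywise inverse of the diagonal `p` of the
preconditioner. -/
def baseOptStep {n : ℕ} (η : ℝ) (p : Fin n → ℝ) (g₂ : Vec n) : Vec n :=
  WithLp.toLp 2 fun i => -η * ((p i)⁻¹ * g₂ i)

/-! ### FOSI -/

/-- `u = 1 / |λ̂|`, where `δ` is added to the entries of `|λ̂|` that are smaller than `δ`. -/
def invAbs {κ : Type} (δ : ℝ) (lam : κ → ℝ) : κ → ℝ :=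
  fun i => 1 / (if |lam i| < δ then |lam i| + δ else |lam i|)

/-- UpdateStep, with learning rate `α` for the Newton part and `η` for the base optimizer, whose
preconditioner has the diagonal `p`. -/
def updateStep {n : ℕ} {κ : Type} [Fintype κ] (α η : ℝ) (p : Fin n → ℝ)
    (θ g : Vec n) (V : Matrix (Fin n) κ ℝ) (u : κ → ℝ) : Vec n :=
  let g₁ := colProj V g
  let g₂ := g - colProj V g
  let d₁ : Vec n := -(α • WithLp.toLp 2 (V.mulVec fun i => V.transpose.mulVec g₁.ofLp i * u i))
  let db := baseOptStep η p g₂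
  let d₂ := db - colProj V db
  θ + d₁ + d₂

/-- The data that determine a run of FOSI with mini-batches. -/
structure FOSI (n d k l : ℕ) where
  /-- the loss `F(θ, x)` -/
  F : Vec n → Vec d → ℝ
  /-- the base optimizer -/
  baseOpt : BaseOpt n
  /-- the ESE procedure used at iteration `t` -/
  ese : ℕ → ESE n k l
  /-- an ESE call at iteration `t` is made with the batch function `f^i` for `i = eseBatch t` -/
  eseBatch : ℕ → ℕ
  /-- the number of samples in the batch of iteration `t` -/
  batchSize : ℕ → ℕ
  /-- number of iterations between two ESE calls -/
  T : ℕ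
  /-- number of warmup iterations -/
  W : ℕ
  /-- the constant that is added to small entries of `|λ̂|` -/
  damping : ℝ
  /-- the step size of iteration `t` -/
  stepSize : ℕ → ℝ
  /-- the initial point -/
  init : Vec n

/-- The variables of FOSI at the beginning of iteration `t`. -/
structure FOSIState (n k l t : ℕ) where
  /-- the parameter vector `θ_t` -/
  θ : Vec n
  /-- the vector `u` -/
  u : Fin k ⊕ Fin l → ℝ
  /-- the matrix `V̂` -/
  V : Matrix (Fin n) (Fin k ⊕ Fin l) ℝ
  /-- the vectors `g₂` of the iterations `0, …, t - 1` -/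
  hist : Fin t → Vec n

namespace FOSI

variable {n d k l : ℕ}

/-- A sequence of batches `b_0, b_1, …`. -/
abbrev Batches (A : FOSI n d k l) : Type := (t : ℕ) → Fin (A.batchSize t) → Vec d

/-- The batch function `f^t(θ) = (1/m_t) ∑ F(θ, x_i)`. -/
def batchLoss (A : FOSI n d k l) (b : A.Batches) (t : ℕ) (θ : Vec n) : ℝ :=
  (1 / (A.batchSize t : ℝ)) * ∑ i, A.F θ (b t i)

/-- ESE is called at iteration `t`. -/
def IsESETime (A : FOSI n d k l) (t : ℕ) : Prop := A.W ≤ t ∧ (t - A.W) % A.T = 0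

instance (A : FOSI n d k l) (t : ℕ) : Decidable (A.IsESETime t) :=
  inferInstanceAs (Decidable (_ ∧ _))

/-- The possible ESE call at iteration `t`, on the Hessian of `f^i` at `θ_t`. -/
def runESE (A : FOSI n d k l) (b : A.Batches) (t : ℕ) (s : FOSIState n k l t) :
    FOSIState n k l t :=
  if A.IsESETime t then
    let H := hessianMatrix (A.batchLoss b (A.eseBatch t)) s.θ
    { s with
      u := invAbs A.damping ((A.ese t).eigval H)
      V := Matrix.of ((A.ese t).eigvec H) }
  else s

/-- One iteration of FOSI: the possible ESE call, the stochastic gradient `g = ∇f^t(θ_t)`, and the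
update step, in which the base optimizer uses the preconditioner computed from the vectors `g₂` of
the earlier iterations; then the current `g₂` is passed to the base optimizer. -/
def step (A : FOSI n d k l) (b : A.Batches) (t : ℕ) (s : FOSIState n k l t) :
    FOSIState n k l (t + 1) :=
  let s' := A.runESE b t s
  let g := gradient (A.batchLoss b t) s'.θ
  { θ := updateStep (A.stepSize t) (A.stepSize t) (A.baseOpt.prec t s'.hist) s'.θ g s'.V s'.u
    u := s'.u
    V := s'.V
    hist := Fin.snoc s'.hist (g - colProj s'.V g) }

/-- The state at the beginning of iteration `t` of the run on the batches `b`. -/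
def state (A : FOSI n d k l) (b : A.Batches) : (t : ℕ) → FOSIState n k l t
  | 0 => { θ := A.init, u := 0, V := 0, hist := Fin.elim0 }
  | t + 1 => A.step b t (A.state b t)

/-- The iterate `θ_t`. -/
def iterate (A : FOSI n d k l) (b : A.Batches) (t : ℕ) : Vec n := (A.state b t).θ

/-- The diagonal of the base optimizer's preconditioner at iteration `t`. -/
def precDiag (A : FOSI n d k l) (b : A.Batches) (t : ℕ) : Fin n → ℝ :=
  A.baseOpt.prec t (A.state b t).hist

/-- The objective `f(θ) = E_x [F(θ, x)]`, where `x` has the distribution `D`. -/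
def objective (A : FOSI n d k l) (D : Measure (Vec d)) (θ : Vec n) : ℝ := ∫ x, A.F θ x ∂D

end FOSI

end

/-! ### Sequences satisfying the descent recursion -/

/-! A FOSI iteration is a preconditioned stochastic gradient step `θ - η P g` with `P = V diag(u) Vᵀ
+ (1 - V Vᵀ) diag(p)⁻¹ (1 - V Vᵀ)`. This `P` is symmetric, and its spectrum lies between `a = 1 /
max z (2 δ)` and `K = max (1/δ) (1/ρ)`. Lanczos need not have converged: the Ritz vectors are
orthonormal, and a Ritz value is a Rayleigh quotient of a batch Hessian, hence at most `z` in
absolute value (`IsESEOutput.orthonormal_and_rayleigh`, `inner_stepDir`, `norm_stepDir_le`).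

`P` and `θ_t` are functions of the earlier batches, so they are independent of each sample of the
current batch. In the descent inequality `LSmooth.descent` the term linear in the noise therefore
has mean zero (`integral_inner_noise`), and the quadratic one costs at most a multiple of `η² σ²`.
The other second-order term, `η² ‖∇f‖²`, is absorbed by `‖∇f‖² ≤ 4 L (f - flow)` instead of by a
smallness condition on `c`. With `D_t` the expected gap and `G_t` the expected squared gradient
norm, this gives `D_{t+1} ≤ (1 + K' η_t²) D_t - a η_t G_t + B η_t²` (`gap_succ_le`).

Since `2 β > 1`, the `η_t²` are summable, so a discrete Gronwall argument bounds all `D_t`.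
Telescoping then bounds `∑ η_t G_t`, and `η_t ≥ c N^(-β)` for the first `N` iterations makes the
average of the `G_t` at most a constant times `N^(β - 1)` (`exists_iteration_bound`). -/

lemma summable_stepSize_sq (c : ℝ) {β : ℝ} (hβ : 1 / 2 < β) :
    Summable fun t : ℕ => (c * ((t : ℝ) + 1) ^ (-β)) ^ 2 := by
  have h : Summable fun t : ℕ => ((t : ℝ)) ^ (-(2 * β)) :=
    Real.summable_nat_rpow.2 (by linarith)
  have h1 := ((summable_nat_add_iff 1).2 h).mul_left (c ^ 2)
  refine h1.congr fun t => ?_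
  have : (0 : ℝ) ≤ (t : ℝ) + 1 := by positivity
  rw [mul_pow, ← Real.rpow_natCast (((t : ℝ) + 1) ^ (-β)), ← Real.rpow_mul this]
  push_cast
  ring_nf

/-- Discrete Gronwall inequality: each factor `1 + K η²` is at most `exp (K η²)`, and the exponents
add up. -/
lemma le_of_descent_recursion {D η : ℕ → ℝ} {K B : ℝ} (hK : 0 ≤ K) (hB : 0 ≤ B)
    (hrec : ∀ t, D (t + 1) ≤ (1 + K * η t ^ 2) * D t + B * η t ^ 2) (hD : ∀ t, 0 ≤ D t) (t : ℕ) :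
    D t ≤ (D 0 + B * ∑ s ∈ Finset.range t, η s ^ 2) *
      Real.exp (K * ∑ s ∈ Finset.range t, η s ^ 2) := by
  induction t with
  | zero => simp
  | succ t ih =>
    set S := ∑ s ∈ Finset.range t, η s ^ 2 with hS
    have hS0 : 0 ≤ S := Finset.sum_nonneg fun _ _ => sq_nonneg _
    rw [Finset.sum_range_succ, ← hS]
    have h0 := sq_nonneg (η t)
    have hKη : 0 ≤ K * η t ^ 2 := by positivity
    have hBη : 0 ≤ B * η t ^ 2 := by positivity
    have he : 1 + K * η t ^ 2 ≤ Real.exp (K * η t ^ 2) := by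
      linarith [Real.add_one_le_exp (K * η t ^ 2)]
    have he1 : 1 ≤ Real.exp (K * (S + η t ^ 2)) := Real.one_le_exp (by positivity)
    calc D (t + 1) ≤ (1 + K * η t ^ 2) * D t + B * η t ^ 2 := hrec t
      _ ≤ Real.exp (K * η t ^ 2) * ((D 0 + B * S) * Real.exp (K * S)) + B * η t ^ 2 := by
          gcongr
          exact hD t
      _ = (D 0 + B * S) * Real.exp (K * (S + η t ^ 2)) + B * η t ^ 2 := by
          rw [mul_add K, Real.exp_add]; ring
      _ ≤ (D 0 + B * S) * Real.exp (K * (S + η t ^ 2))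
            + B * η t ^ 2 * Real.exp (K * (S + η t ^ 2)) := by
          nlinarith
      _ = _ := by ring

/-- A sequence of suboptimality gaps `D` satisfying the descent recursion with polynomially decaying
step sizes forces the averages of the squared gradient norms `G` to decay polynomially. -/
lemma exists_iteration_bound {c β a K B : ℝ} (Δ : ℝ) (hc : 0 < c)
    (hβ : β ∈ Set.Ioo (1 / 2 : ℝ) 1) (ha : 0 < a) (hK : 0 ≤ K) (hB : 0 ≤ B) :
    ∃ C : ℝ, 0 < C ∧ ∀ D G η : ℕ → ℝ, (∀ t, 0 ≤ D t) → (∀ t, 0 ≤ G t) → D 0 ≤ Δ →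
      (∀ t, η t = c * ((t : ℝ) + 1) ^ (-β)) →
      (∀ t, D (t + 1) ≤ (1 + K * η t ^ 2) * D t - a * η t * G t + B * η t ^ 2) →
      ∀ ε ∈ Set.Ioo (0 : ℝ) 1, ∀ N : ℕ, C * ε ^ (-(1 / (1 - β))) ≤ N →
        (1 / (N : ℝ)) * ∑ t ∈ Finset.range N, G t ≤ ε := by
  obtain ⟨hβ0, hβ1⟩ := hβ
  set S₂ : ℝ := ∑' t : ℕ, (c * ((t : ℝ) + 1) ^ (-β)) ^ 2 with hS₂
  have hS₂0 : 0 ≤ S₂ := tsum_nonneg fun _ => sq_nonneg _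
  -- `M` bounds every gap `D t`, and `S` bounds `a ∑ η_t G_t`. The summand `1` makes `S` positive,
  -- hence `C > 0`, which later forces `N > 0`.
  set M : ℝ := (|Δ| + B * S₂) * Real.exp (K * S₂) with hM
  have hM0 : 0 ≤ M := by positivity
  set S : ℝ := |Δ| + (K * M + B) * S₂ + 1 with hS
  have hS0 : 0 < S := by positivity
  have hβ' : 0 < 1 - β := by linarith
  -- Chosen so that `S / (a c) * N ^ (β - 1) ≤ ε` once `N ≥ C ε ^ (-(1 / (1 - β)))`.
  refine ⟨(S / (a * c)) ^ (1 / (1 - β)), by positivity, ?_⟩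
  intro D G η hD hG hD0 hη hrec ε ⟨hε0, hε1⟩ N hN
  have hηpos : ∀ t, 0 < η t := fun t => by rw [hη]; positivity
  have hsum : ∀ t, ∑ s ∈ Finset.range t, η s ^ 2 ≤ S₂ := fun t => by
    simp only [hη]
    exact (summable_stepSize_sq c hβ0).sum_le_tsum _ fun _ _ => sq_nonneg _
  have hDM : ∀ t, D t ≤ M := fun t => by
    refine (le_of_descent_recursion (η := η) hK hB (fun t => ?_) hD t).trans ?_
    · have := mul_nonneg (mul_nonneg ha.le (hηpos t).le) (hG t)
      linarith [hrec t]
    · rw [hM]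
      have := hsum t
      have h0 : 0 ≤ ∑ s ∈ Finset.range t, η s ^ 2 := Finset.sum_nonneg fun _ _ => sq_nonneg _
      have := hD0.trans (le_abs_self Δ)
      gcongr
  -- With the gaps bounded by `M`, the factor `1 + K η²` contributes only an additive `K M η²`, so
  -- the recursion telescopes.
  have htel : ∀ N, a * ∑ t ∈ Finset.range N, η t * G t
      ≤ D 0 - D N + (K * M + B) * ∑ t ∈ Finset.range N, η t ^ 2 := fun N => by
    induction N with
    | zero => simp
    | succ N ih =>
      rw [Finset.sum_range_succ, Finset.sum_range_succ, mul_add, mul_add]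
      have h1 := mul_le_mul_of_nonneg_left (hDM N) (mul_nonneg hK (sq_nonneg (η N)))
      nlinarith [hrec N]
  have hN0 : (0 : ℝ) < N := lt_of_lt_of_le (by positivity) hN
  -- The step sizes decrease, so those of the first `N` iterations are at least the last one, `c N ^
  -- (-β)`.
  have hηN : ∀ t ∈ Finset.range N, c * (N : ℝ) ^ (-β) * G t ≤ η t * G t := fun t ht => by
    rw [hη]
    have ht' : (t : ℝ) + 1 ≤ N := by exact_mod_cast Finset.mem_range.1 ht
    have : (N : ℝ) ^ (-β) ≤ ((t : ℝ) + 1) ^ (-β) :=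
      Real.rpow_le_rpow_of_nonpos (by positivity) ht' (by linarith)
    have := hG t
    gcongr
  have hbound : a * (c * (N : ℝ) ^ (-β)) * ∑ t ∈ Finset.range N, G t ≤ S := by
    calc a * (c * (N : ℝ) ^ (-β)) * ∑ t ∈ Finset.range N, G t
        = a * ∑ t ∈ Finset.range N, c * (N : ℝ) ^ (-β) * G t := by
          rw [mul_assoc, Finset.mul_sum]
      _ ≤ a * ∑ t ∈ Finset.range N, η t * G t :=
          mul_le_mul_of_nonneg_left (Finset.sum_le_sum hηN) ha.le
      _ ≤ D 0 - D N + (K * M + B) * ∑ t ∈ Finset.range N, η t ^ 2 := htel N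
      _ ≤ |Δ| - 0 + (K * M + B) * S₂ := by
          have := hsum N
          have := hD N
          have := hD0.trans (le_abs_self Δ)
          gcongr
      _ ≤ S := by rw [hS]; linarith
  have hpow : S / (a * c) ≤ ε * (N : ℝ) ^ (1 - β) := by
    have h1 := Real.rpow_le_rpow (by positivity) hN hβ'.le
    rw [Real.mul_rpow (by positivity) (by positivity), ← Real.rpow_mul (by positivity),
      ← Real.rpow_mul hε0.le, one_div, inv_mul_cancel₀ hβ'.ne', Real.rpow_one, neg_mul,
      inv_mul_cancel₀ hβ'.ne', Real.rpow_neg_one] at h1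
    calc S / (a * c) = ε * (S / (a * c) * ε⁻¹) := by field_simp
      _ ≤ _ := by gcongr
  have hsplit : (N : ℝ) ^ (1 - β) = N * (N : ℝ) ^ (-β) := by
    rw [sub_eq_add_neg, Real.rpow_add hN0, Real.rpow_one]
  rw [hsplit, div_le_iff₀ (by positivity)] at hpow
  rw [one_div, inv_mul_le_iff₀ hN0]
  have hNβ : 0 < a * (c * (N : ℝ) ^ (-β)) := by positivity
  refine le_of_mul_le_mul_left ?_ hNβ
  linarith

/-! ### Smooth functions -/

/-- The mean value theorem at one point of the segment gives the constant `L` instead of the sharp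
`L / 2`, which suffices here. -/
lemma LSmooth.le_add_inner {n : ℕ} {L : ℝ≥0} {f : Vec n → ℝ} (hf : LSmooth L f) (x y : Vec n) :
    f y ≤ f x + inner ℝ (∇ f x) (y - x) + L * ‖y - x‖ ^ 2 := by
  obtain ⟨w, hw, hfw⟩ := domain_mvt (f := f) (s := Set.univ) (x := x) (y := y)
    (f' := fun w => fderiv ℝ f w) (fun w _ => (hf.1 w).hasFDerivAt.hasFDerivWithinAt)
    convex_univ (Set.mem_univ _) (Set.mem_univ _)
  have h1 : fderiv ℝ f w (y - x) = inner ℝ (∇ f w) (y - x) := by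
    rw [gradient, InnerProductSpace.toDual_symm_apply]
  have h2 : inner ℝ (∇ f w) (y - x) = inner ℝ (∇ f x) (y - x)
      + inner ℝ (∇ f w - ∇ f x) (y - x) := by
    rw [inner_sub_left]; ring
  have h3 : inner ℝ (∇ f w - ∇ f x) (y - x) ≤ L * ‖y - x‖ * ‖y - x‖ := by
    refine (real_inner_le_norm _ _).trans ?_
    have h4 := hf.2.dist_le_mul w x
    have h5 : dist w x ≤ ‖y - x‖ := by
      rw [dist_eq_norm]
      obtain ⟨a, b, ha, hb, hab, rfl⟩ := hw
      have : a • x + b • y - x = b • (y - x) := by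
        have : a = 1 - b := by linarith
        subst this; module
      rw [this, norm_smul, Real.norm_of_nonneg hb]
      exact mul_le_of_le_one_left (norm_nonneg _) (by linarith)
    rw [dist_eq_norm] at h4
    gcongr
    exact h4.trans (by gcongr)
  rw [h1, h2] at hfw
  nlinarith

/-- A gradient step of length `1 / (2 L)` minimizes the quadratic upper bound and lowers it by `‖∇ f
x‖² / (4 L)`; the value reached is still at least `flow`. -/
lemma LSmooth.norm_gradient_sq_le {n : ℕ} {L : ℝ≥0} {f : Vec n → ℝ} (hf : LSmooth L f)
    (hL : 0 < L) {flow : ℝ} (hlow : ∀ x, flow ≤ f x) (x : Vec n) :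
    ‖∇ f x‖ ^ 2 ≤ 4 * L * (f x - flow) := by
  have hL' : (0 : ℝ) < L := hL
  have h := hf.le_add_inner x (x - (1 / (2 * L) : ℝ) • ∇ f x)
  have h1 := hlow (x - (1 / (2 * L) : ℝ) • ∇ f x)
  rw [sub_sub_cancel_left, inner_neg_right, norm_neg, inner_smul_right,
    real_inner_self_eq_norm_sq, norm_smul, mul_pow, Real.norm_of_nonneg (by positivity)] at h
  have h2 : flow ≤ f x - ‖∇ f x‖ ^ 2 / (4 * L) := by
    refine (h1.trans h).trans (le_of_eq ?_)
    field_simp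
    ring
  have h3 : ‖∇ f x‖ ^ 2 / (4 * L) ≤ f x - flow := by linarith
  rw [div_le_iff₀ (by positivity)] at h3
  linarith

lemma LSmooth.mono {n : ℕ} {L L' : ℝ≥0} {f : Vec n → ℝ} (hf : LSmooth L f) (h : L ≤ L') :
    LSmooth L' f :=
  ⟨hf.1, hf.2.weaken h⟩

/-! ### The preconditioned direction -/

/-- The direction `V̂ diag(u) V̂ᵀ g + (1 - V̂ V̂ᵀ) diag(p)⁻¹ (1 - V̂ V̂ᵀ) g` of an update step. -/
noncomputable def stepDir {n : ℕ} {κ : Type} [Fintype κ] (p : Fin n → ℝ)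
    (V : Matrix (Fin n) κ ℝ) (u : κ → ℝ) (g : Vec n) : Vec n :=
  WithLp.toLp 2 (V.mulVec fun i => V.transpose.mulVec (colProj V g).ofLp i * u i)
    - (baseOptStep 1 p (g - colProj V g) - colProj V (baseOptStep 1 p (g - colProj V g)))

section StepDir

variable {n : ℕ} {κ : Type} [Fintype κ]

lemma colProj_smul (V : Matrix (Fin n) κ ℝ) (a : ℝ) (g : Vec n) :
    colProj V (a • g) = a • colProj V g := by
  simp only [colProj, WithLp.ofLp_smul, Matrix.mulVec_smul, WithLp.toLp_smul]

lemma baseOptStep_eq_smul (η : ℝ) (p : Fin n → ℝ) (g : Vec n) :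
    baseOptStep η p g = η • baseOptStep 1 p g := by
  ext i; simp [baseOptStep]

lemma updateStep_eq (η : ℝ) (p : Fin n → ℝ) (θ g : Vec n) (V : Matrix (Fin n) κ ℝ) (u : κ → ℝ) :
    updateStep η η p θ g V u = θ - η • stepDir p V u g := by
  simp only [updateStep, stepDir]
  rw [baseOptStep_eq_smul η, colProj_smul]
  module

lemma inner_toLp_mulVec (V : Matrix (Fin n) κ ℝ) (h : Vec n) (x : κ → ℝ) :
    inner ℝ h (WithLp.toLp 2 (V.mulVec x)) = ∑ i, V.transpose.mulVec h.ofLp i * x i := by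
  rw [EuclideanSpace.inner_eq_star_dotProduct, star_trivial, dotProduct_comm,
    Matrix.dotProduct_mulVec, ← Matrix.mulVec_transpose]
  rfl

lemma inner_colProj (V : Matrix (Fin n) κ ℝ) (h g : Vec n) :
    inner ℝ h (colProj V g)
      = ∑ i, V.transpose.mulVec h.ofLp i * V.transpose.mulVec g.ofLp i :=
  inner_toLp_mulVec V h _

lemma inner_colProj_left (V : Matrix (Fin n) κ ℝ) (h g : Vec n) :
    inner ℝ (colProj V h) g = inner ℝ h (colProj V g) := by
  rw [real_inner_comm, inner_colProj, inner_colProj]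
  exact Finset.sum_congr rfl fun i _ => mul_comm _ _

variable {V : Matrix (Fin n) κ ℝ} (hV : V.transpose * V * V.transpose = V.transpose)
include hV

/-- The hypothesis `hV` makes `V Vᵀ` an orthogonal projection. It holds for orthonormal columns and
also for the initial `V = 0`, so the warmup iterations need no separate treatment. -/
lemma transpose_mulVec_colProj (g : Vec n) :
    V.transpose.mulVec (colProj V g).ofLp = V.transpose.mulVec g.ofLp := by
  simp only [colProj, Matrix.mulVec_mulVec]
  rw [← Matrix.mul_assoc, hV]

lemma colProj_colProj (g : Vec n) : colProj V (colProj V g) = colProj V g := by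
  conv_lhs => rw [colProj, transpose_mulVec_colProj hV]
  rfl

lemma norm_sq_eq_add_norm_sub_colProj_sq (g : Vec n) :
    ‖g‖ ^ 2 = ∑ i, V.transpose.mulVec g.ofLp i ^ 2 + ∑ j, (g - colProj V g) j ^ 2 := by
  have h1 : ∑ i, V.transpose.mulVec g.ofLp i ^ 2 = inner ℝ g (colProj V g) := by
    rw [inner_colProj]; exact Finset.sum_congr rfl fun i _ => sq _
  have h2 : inner ℝ (colProj V g) (colProj V g) = inner ℝ g (colProj V g) := by
    rw [inner_colProj_left, colProj_colProj hV]
  rw [h1, ← EuclideanSpace.real_norm_sq_eq, norm_sub_sq_real,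
    ← real_inner_self_eq_norm_sq (colProj V g), h2]
  ring

/-- The bilinear form of the step is diagonal in the coordinates `Vᵀ g` and `g - V Vᵀ g`, whose
squares sum to `‖g‖²`. Symmetry and both spectral bounds can thus be read off coordinatewise. -/
lemma inner_stepDir (p : Fin n → ℝ) (u : κ → ℝ) (h g : Vec n) :
    inner ℝ h (stepDir p V u g)
      = ∑ i, u i * (V.transpose.mulVec h.ofLp i * V.transpose.mulVec g.ofLp i)
        + ∑ j, (p j)⁻¹ * ((h - colProj V h) j * (g - colProj V g) j) := by
  set b := baseOptStep 1 p (g - colProj V g) with hb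
  rw [stepDir, inner_sub_right, inner_toLp_mulVec, transpose_mulVec_colProj hV, inner_sub_right,
    ← inner_colProj_left, ← inner_sub_left, sub_eq_add_neg]
  congr 1
  · exact Finset.sum_congr rfl fun i _ => by ring
  · rw [PiLp.inner_apply, ← Finset.sum_neg_distrib]
    refine Finset.sum_congr rfl fun j _ => ?_
    simp only [baseOptStep, RCLike.inner_apply, conj_trivial]
    ring

lemma inner_stepDir_comm (p : Fin n → ℝ) (u : κ → ℝ) (h g : Vec n) :
    inner ℝ h (stepDir p V u g) = inner ℝ (stepDir p V u h) g := by
  rw [real_inner_comm g, inner_stepDir hV, inner_stepDir hV]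
  congr 1 <;> exact Finset.sum_congr rfl fun i _ => by ring

/-- A zero column contributes nothing to either side, so its entry of `u` may be arbitrary; this
covers the initial `u = 0`. -/
lemma le_inner_stepDir {p : Fin n → ℝ} {u : κ → ℝ} {a : ℝ} (hp : ∀ j, a ≤ (p j)⁻¹)
    (hu : ∀ i, a ≤ u i ∨ ∀ j, V j i = 0) (g : Vec n) :
    a * ‖g‖ ^ 2 ≤ inner ℝ g (stepDir p V u g) := by
  rw [inner_stepDir hV, norm_sq_eq_add_norm_sub_colProj_sq hV g, mul_add, Finset.mul_sum,
    Finset.mul_sum]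
  refine add_le_add (Finset.sum_le_sum fun i _ => ?_) (Finset.sum_le_sum fun j _ => ?_)
  · rw [← sq]
    rcases hu i with h | h
    · gcongr
    · simp [Matrix.mulVec, dotProduct, h]
  · rw [← sq]
    exact mul_le_mul_of_nonneg_right (hp j) (sq_nonneg _)

/-- Pair `h = P g` with itself, expand the diagonal form and apply Young's inequality to each
coordinate: `‖h‖² ≤ (‖h‖² + K² ‖g‖²) / 2`. -/
lemma norm_stepDir_le {p : Fin n → ℝ} {u : κ → ℝ} {K : ℝ} (hK : 0 ≤ K) (hp : ∀ j, |(p j)⁻¹| ≤ K)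
    (hu : ∀ i, |u i| ≤ K ∨ ∀ j, V j i = 0) (g : Vec n) :
    ‖stepDir p V u g‖ ≤ K * ‖g‖ := by
  have key : ∀ r x y : ℝ, |r| ≤ K → r * (x * y) ≤ (x ^ 2 + K ^ 2 * y ^ 2) / 2 := fun r x y hr => by
    have : r ^ 2 ≤ K ^ 2 := sq_le_sq' (abs_le.1 hr).1 (abs_le.1 hr).2
    nlinarith [sq_nonneg (x - r * y), mul_le_mul_of_nonneg_right this (sq_nonneg y)]
  set h := stepDir p V u g with hh
  have h1 : ‖h‖ ^ 2 ≤ (‖h‖ ^ 2 + K ^ 2 * ‖g‖ ^ 2) / 2 := by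
    conv_lhs => rw [← real_inner_self_eq_norm_sq]
    conv_lhs => rw [hh, ← hh, inner_stepDir hV]
    rw [norm_sq_eq_add_norm_sub_colProj_sq hV g, norm_sq_eq_add_norm_sub_colProj_sq hV h]
    have e1 : ∑ i, u i * (V.transpose.mulVec h.ofLp i * V.transpose.mulVec g.ofLp i)
        ≤ ∑ i, (V.transpose.mulVec h.ofLp i ^ 2 + K ^ 2 * V.transpose.mulVec g.ofLp i ^ 2) / 2 := by
      refine Finset.sum_le_sum fun i _ => ?_
      rcases hu i with h | h
      · exact key _ _ _ h
      · simp [Matrix.mulVec, dotProduct, h]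
    have e2 : ∑ j, (p j)⁻¹ * ((h - colProj V h) j * (g - colProj V g) j)
        ≤ ∑ j, ((h - colProj V h) j ^ 2 + K ^ 2 * (g - colProj V g) j ^ 2) / 2 :=
      Finset.sum_le_sum fun j _ => key _ _ _ (hp j)
    rw [← Finset.sum_div, Finset.sum_add_distrib, ← Finset.mul_sum] at e1 e2
    linarith
  refine le_of_sq_le_sq ?_ (by positivity)
  rw [mul_pow]
  linarith

end StepDir

/-! ### Output of the extreme spectrum estimation -/

lemma add_le_lanczosSteps {n k l : ℕ} (h : k + l ≤ n) : k + l ≤ lanczosSteps n k l :=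
  le_min h (le_max_of_le_left (by omega))

lemma IsLanczosOutput.compression_eq {n m : ℕ} {A : Matrix (Fin n) (Fin n) ℝ}
    {U : Matrix (Fin n) (Fin m) ℝ} {T : Matrix (Fin m) (Fin m) ℝ} (h : IsLanczosOutput A U T) :
    U.transpose * A * U = T := by
  have := h.residual
  rw [Matrix.mul_sub, ← Matrix.mul_assoc, ← Matrix.mul_assoc, h.orthonormal, Matrix.one_mul,
    sub_eq_zero] at this
  exact this

/-- The Ritz vectors are orthonormal, and each Ritz value is the Rayleigh quotient of its Ritz
vector. -/
lemma IsESEOutput.orthonormal_and_rayleigh {n k l : ℕ} {A : Matrix (Fin n) (Fin n) ℝ}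
    {lam : Fin k ⊕ Fin l → ℝ} {V : Matrix (Fin n) (Fin k ⊕ Fin l) ℝ} (hkl : k + l ≤ n)
    (h : IsESEOutput A lam V) :
    V.transpose * V = 1 ∧ ∀ i, lam i = (V.transpose * A * V) i i := by
  obtain ⟨U, T, Q, Λ, hL, hQ, hT, -, h1, h2⟩ := h
  choose r₁ hr₁ hlam₁ hV₁ using h1
  choose r₂ hr₂ hlam₂ hV₂ using h2
  have hm := add_le_lanczosSteps hkl
  let r : Fin k ⊕ Fin l → Fin (lanczosSteps n k l) := Sum.elim r₁ r₂
  have hVr : V = (U * Q).submatrix id r := by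
    ext a (i | j)
    · exact hV₁ i a
    · exact hV₂ j a
  have hlr : ∀ i, lam i = Λ (r i) := by
    rintro (i | j)
    · exact hlam₁ i
    · exact hlam₂ j
  -- The first `k` and the last `l` indices do not overlap, because `k + l` is at most the number of
  -- Lanczos steps.
  have hinj : Function.Injective r := by
    rintro (i | i) (j | j) hij <;> simp only [r, Sum.elim_inl, Sum.elim_inr] at hij <;>
      have hij' := congrArg Fin.val hij
    · rw [hr₁, hr₁] at hij'
      rw [Fin.ext hij']
    · have := hr₁ i; have := hr₂ j; omega
    · have := hr₁ j; have := hr₂ i; omega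
    · have := hr₂ i
      have := hr₂ j
      rw [Fin.ext (a := i) (b := j) (by omega)]
  have hUQ : (U * Q).transpose * (U * Q) = 1 := by
    rw [Matrix.transpose_mul, Matrix.mul_assoc, ← Matrix.mul_assoc U.transpose, hL.orthonormal,
      Matrix.one_mul, hQ]
  have hUAQ : (U * Q).transpose * A * (U * Q) = Matrix.diagonal Λ := by
    calc (U * Q).transpose * A * (U * Q) = Q.transpose * (U.transpose * A * U) * Q := by
          simp only [Matrix.transpose_mul, Matrix.mul_assoc]
      _ = (Q.transpose * Q) * Matrix.diagonal Λ * (Q.transpose * Q) := by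
          rw [hL.compression_eq, hT]; simp only [Matrix.mul_assoc]
      _ = _ := by rw [hQ, Matrix.one_mul, Matrix.mul_one]
  constructor
  · have : V.transpose * V = ((U * Q).transpose * (U * Q)).submatrix r r := by rw [hVr]; rfl
    rw [this, hUQ, Matrix.submatrix_one r hinj]
  · intro i
    have : V.transpose * A * V = ((U * Q).transpose * A * (U * Q)).submatrix r r := by
      rw [hVr]; rfl
    rw [this, hUAQ, Matrix.submatrix_apply, Matrix.diagonal_apply_eq, hlr]

/-- Damping sends entries below `δ` into `[δ, 2 δ)`, which is the source of `max z (2 * δ)`. -/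
lemma invAbs_mem_Icc {κ : Type} {δ z : ℝ} (hδ : 0 < δ) {lam : κ → ℝ} {i : κ} (h : |lam i| ≤ z) :
    invAbs δ lam i ∈ Set.Icc (1 / max z (2 * δ)) (1 / δ) := by
  unfold invAbs
  split_ifs with hi
  · have := abs_nonneg (lam i)
    exact ⟨one_div_le_one_div_of_le (by positivity) (le_max_of_le_right (by linarith)),
      one_div_le_one_div_of_le hδ (by linarith)⟩
  · push Not at hi
    exact ⟨one_div_le_one_div_of_le (by linarith) (le_max_of_le_left h),
      one_div_le_one_div_of_le hδ hi⟩

/-! ### The Hessian -/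

lemma hessianMatrix_mulVec {n : ℕ} (g : Vec n → ℝ) (θ : Vec n) (w : Fin n → ℝ) :
    (hessianMatrix g θ).mulVec w = (hessian g θ (WithLp.toLp 2 w)).ofLp := by
  have hw : WithLp.toLp 2 w = ∑ j, w j • EuclideanSpace.single j (1 : ℝ) := by
    ext i
    simp [Pi.single_apply]
  ext i
  rw [hw, map_sum]
  simp [Matrix.mulVec, dotProduct, hessianMatrix, mul_comm]

lemma inner_hessian_comm {n : ℕ} {g : Vec n → ℝ} (hg : Differentiable ℝ g)
    (hg' : Differentiable ℝ (gradient g)) (θ v w : Vec n) :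
    inner ℝ (hessian g θ v) w = inner ℝ (hessian g θ w) v := by
  -- The Riesz map as a plain real-linear map; composed with the gradient it gives the Fréchet
  -- derivative, whose own derivative is symmetric.
  let J : Vec n →L[ℝ] (Vec n →L[ℝ] ℝ) := LinearMap.toContinuousLinearMap
    { toFun := fun v => innerSL ℝ v
      map_add' := fun v w => map_add _ v w
      map_smul' := fun a v => by ext w; simp }
  have hJ : ∀ v w, J v w = inner ℝ v w := fun v w => rfl
  have h := second_derivative_symmetric (𝕜 := ℝ) (f := g) (f' := fun y => J (gradient g y))
    (f'' := J.comp (hessian g θ)) (x := θ) (fun y => (hg y).hasGradientAt.hasFDerivAt)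
    (J.hasFDerivAt.comp θ (hg' θ).hasFDerivAt) v w
  simpa [hJ] using h

lemma hessianMatrix_isSymm {n : ℕ} {g : Vec n → ℝ} (hg : Differentiable ℝ g)
    (hg' : Differentiable ℝ (gradient g)) (θ : Vec n) : (hessianMatrix g θ).IsSymm := by
  ext i j
  have := inner_hessian_comm hg hg' θ (EuclideanSpace.single i 1) (EuclideanSpace.single j 1)
  simpa [EuclideanSpace.inner_single_right, hessianMatrix] using this

lemma abs_rayleigh_hessianMatrix_le {n : ℕ} {κ : Type} [Fintype κ] [DecidableEq κ]
    {g : Vec n → ℝ} {θ : Vec n} {z : ℝ}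
    (hz : ‖hessian g θ‖ ≤ z) {V : Matrix (Fin n) κ ℝ} (hV : V.transpose * V = 1) (i : κ) :
    |(V.transpose * hessianMatrix g θ * V) i i| ≤ z := by
  set w : Vec n := WithLp.toLp 2 fun a => V a i with hw
  have hnorm : ‖w‖ = 1 := by
    have : ‖w‖ ^ 2 = 1 := by
      rw [EuclideanSpace.real_norm_sq_eq]
      have := congrFun (congrFun hV i) i
      simpa [Matrix.mul_apply, hw, sq] using this
    nlinarith [norm_nonneg w]
  have h1 : (V.transpose * hessianMatrix g θ * V) i i = inner ℝ (hessian g θ w) w := by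
    rw [Matrix.mul_assoc, Matrix.mul_apply, PiLp.inner_apply, hw]
    refine Finset.sum_congr rfl fun a _ => ?_
    rw [← hessianMatrix_mulVec]
    simp [Matrix.mul_apply, Matrix.mulVec, dotProduct]
  rw [h1]
  calc |inner ℝ (hessian g θ w) w| ≤ ‖hessian g θ w‖ * ‖w‖ := abs_real_inner_le_norm _ _
    _ ≤ ‖hessian g θ‖ * ‖w‖ * ‖w‖ := by gcongr; exact (hessian g θ).le_opNorm w
    _ ≤ z := by rw [hnorm]; linarith

/-! ### Measurability of derivatives depending on a parameter -/

lemma measurable_vec_iff {Ω : Type*} [MeasurableSpace Ω] {n : ℕ} {f : Ω → Vec n} :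
    Measurable f ↔ ∀ i, Measurable fun ω => f ω i :=
  ⟨fun h i => (measurable_pi_apply i).comp ((WithLp.measurable_ofLp 2 _).comp h),
    fun h => (WithLp.measurable_toLp 2 _).comp (measurable_pi_iff.2 h)⟩

/-- A directional derivative is the pointwise limit of difference quotients with increments `v / N`,
each jointly measurable; no regularity in the parameter is needed. -/
lemma measurable_fderiv_apply_of_measurable_uncurry {E G Y : Type*} [NormedAddCommGroup E]
    [NormedSpace ℝ E] [MeasurableSpace E] [BorelSpace E] [SecondCountableTopology E]
    [NormedAddCommGroup G] [NormedSpace ℝ G] [MeasurableSpace G] [BorelSpace G]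
    [SecondCountableTopology G] [MeasurableSpace Y] {h : E → Y → G}
    (hm : Measurable (Function.uncurry h)) (hd : ∀ y, Differentiable ℝ fun x => h x y) (v : E) :
    Measurable fun q : E × Y => fderiv ℝ (fun x => h x q.2) q.1 v := by
  refine measurable_of_tendsto_metrizable (f := fun (N : ℕ) (q : E × Y) =>
    (N : ℝ) • (h (q.1 + (N : ℝ)⁻¹ • v) q.2 - h q.1 q.2)) (fun N => ?_) ?_
  · have h1 : Measurable fun q : E × Y => h (q.1 + (N : ℝ)⁻¹ • v) q.2 :=
      hm.comp ((measurable_fst.add_const _).prodMk measurable_snd)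
    exact (h1.sub hm).const_smul (N : ℝ)
  · refine tendsto_pi_nhds.2 fun q => ?_
    refine (hd q.2 q.1).hasFDerivAt.lim v ?_
    simpa using tendsto_natCast_atTop_atTop (R := ℝ)

section Param

variable {n : ℕ} {Y : Type*} [MeasurableSpace Y] {h : Vec n → Y → ℝ}
  (hm : Measurable (Function.uncurry h)) (hd : ∀ y, Differentiable ℝ fun x => h x y)
include hm hd

lemma measurable_gradient_of_measurable_uncurry :
    Measurable fun q : Vec n × Y => gradient (fun x => h x q.2) q.1 := by
  refine measurable_vec_iff.2 fun i => ?_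
  have h1 : (fun q : Vec n × Y => gradient (fun x => h x q.2) q.1 i)
      = fun q => fderiv ℝ (fun x => h x q.2) q.1 (EuclideanSpace.single i 1) := by
    funext q
    rw [← inner_gradient_left, EuclideanSpace.inner_single_right]
    simp
  rw [h1]
  exact measurable_fderiv_apply_of_measurable_uncurry hm hd _

lemma measurable_hessianMatrix_of_measurable_uncurry
    (hd' : ∀ y, Differentiable ℝ (gradient fun x => h x y)) :
    Measurable fun q : Vec n × Y => fun i j => hessianMatrix (fun x => h x q.2) q.1 i j := by
  refine measurable_pi_iff.2 fun i => measurable_pi_iff.2 fun j => ?_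
  exact measurable_vec_iff.1 (measurable_fderiv_apply_of_measurable_uncurry
    (h := fun x y => gradient (fun x => h x y) x)
    (measurable_gradient_of_measurable_uncurry hm hd) hd' (EuclideanSpace.single j 1)) i

end Param

/-! ### Batch functions -/

section Average

variable {n : ℕ} {ι : Type*} [Fintype ι] {g : ι → Vec n → ℝ} (hg : ∀ i, Differentiable ℝ (g i))
include hg

lemma gradient_const_mul_sum (a : ℝ) :
    gradient (fun θ => a * ∑ i, g i θ) = fun θ => a • ∑ i, gradient (g i) θ := by
  funext θ
  refine ext_inner_right ℝ fun v => ?_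
  have h1 : HasFDerivAt (fun θ => a * ∑ i, g i θ) (a • ∑ i, fderiv ℝ (g i) θ) θ :=
    (HasFDerivAt.fun_sum fun i _ => (hg i θ).hasFDerivAt).const_mul _
  rw [inner_gradient_left, h1.fderiv, real_inner_smul_left, sum_inner]
  simp [inner_gradient_left]

variable (hg' : ∀ i, Differentiable ℝ (gradient (g i)))
include hg'

lemma differentiable_gradient_const_mul_sum (a : ℝ) :
    Differentiable ℝ (gradient fun θ => a * ∑ i, g i θ) := by
  rw [gradient_const_mul_sum hg]
  fun_prop

lemma hessian_const_mul_sum (a : ℝ) (θ : Vec n) :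
    hessian (fun θ => a * ∑ i, g i θ) θ = a • ∑ i, hessian (g i) θ := by
  rw [hessian, gradient_const_mul_sum hg]
  exact (HasFDerivAt.const_smul (HasFDerivAt.fun_sum fun i _ => (hg' i θ).hasFDerivAt) a).fderiv

end Average

namespace FOSI

variable {n d k l : ℕ} {A : FOSI n d k l}

section BatchLoss

variable (hd : ∀ x, Differentiable ℝ fun θ => A.F θ x)
include hd

lemma differentiable_batchLoss (b : A.Batches) (t : ℕ) : Differentiable ℝ (A.batchLoss b t) := by
  unfold batchLoss
  fun_prop

lemma gradient_batchLoss (b : A.Batches) (t : ℕ) (θ : Vec n) :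
    gradient (A.batchLoss b t) θ
      = (1 / (A.batchSize t : ℝ)) • ∑ i, gradient (fun θ' => A.F θ' (b t i)) θ :=
  congrFun (gradient_const_mul_sum (fun i => hd (b t i)) _) θ

variable (hd' : ∀ x, Differentiable ℝ (gradient fun θ => A.F θ x))
include hd'

lemma differentiable_gradient_batchLoss (b : A.Batches) (t : ℕ) :
    Differentiable ℝ (gradient (A.batchLoss b t)) :=
  differentiable_gradient_const_mul_sum (fun i => hd (b t i)) (fun i => hd' (b t i)) _

lemma hessian_batchLoss (b : A.Batches) (t : ℕ) (θ : Vec n) :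
    hessian (A.batchLoss b t) θ
      = (1 / (A.batchSize t : ℝ)) • ∑ i, hessian (fun θ' => A.F θ' (b t i)) θ :=
  hessian_const_mul_sum (fun i => hd (b t i)) (fun i => hd' (b t i)) _ θ

lemma norm_hessian_batchLoss_le {z : ℝ} (hz : ∀ θ x, ‖hessian (fun θ' => A.F θ' x) θ‖ ≤ z)
    {t : ℕ} (ht : 1 ≤ A.batchSize t) (b : A.Batches) (θ : Vec n) :
    ‖hessian (A.batchLoss b t) θ‖ ≤ z := by
  have ht' : (0 : ℝ) < A.batchSize t := by exact_mod_cast ht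
  rw [hessian_batchLoss hd hd', norm_smul, Real.norm_of_nonneg (by positivity), one_div,
    inv_mul_le_iff₀ ht']
  refine (norm_sum_le _ _).trans ((Finset.sum_le_sum fun i _ => hz θ (b t i)).trans ?_)
  simp

end BatchLoss

/-! ### Measurability of the run -/

/-- A random state all of whose components are measurable. -/
structure MeasurableState {Ω : Type*} [MeasurableSpace Ω] {t : ℕ}
    (s : Ω → FOSIState n k l t) : Prop where
  θ : Measurable fun ω => (s ω).θ
  u : ∀ i, Measurable fun ω => (s ω).u i
  V : ∀ i j, Measurable fun ω => (s ω).V i j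
  hist : Measurable fun ω => (s ω).hist

section Measurability

variable {Ω : Type*} {m : MeasurableSpace Ω} {κ : Type} [Fintype κ]

lemma _root_.measurable_colProj {V : Ω → Matrix (Fin n) κ ℝ} {g : Ω → Vec n}
    (hV : ∀ i j, Measurable fun ω => V ω i j) (hg : Measurable g) :
    Measurable fun ω => colProj (V ω) (g ω) := by
  refine measurable_vec_iff.2 fun i => ?_
  have hg' := measurable_vec_iff.1 hg
  simp only [colProj, Matrix.mulVec, dotProduct, Matrix.transpose_apply]
  fun_prop

lemma _root_.measurable_stepDir {p : Ω → Fin n → ℝ} {V : Ω → Matrix (Fin n) κ ℝ} {u : Ω → κ → ℝ}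
    {g : Ω → Vec n} (hp : ∀ i, Measurable fun ω => p ω i)
    (hV : ∀ i j, Measurable fun ω => V ω i j) (hu : ∀ i, Measurable fun ω => u ω i)
    (hg : Measurable g) : Measurable fun ω => stepDir (p ω) (V ω) (u ω) (g ω) := by
  have h1 := measurable_colProj hV hg
  have h2 : Measurable fun ω => baseOptStep 1 (p ω) (g ω - colProj (V ω) (g ω)) := by
    refine measurable_vec_iff.2 fun i => ?_
    have := measurable_vec_iff.1 (hg.sub h1) i
    simp only [baseOptStep]
    exact (((hp i).inv).mul this).const_mul _
  refine Measurable.sub (measurable_vec_iff.2 fun i => ?_) (h2.sub (measurable_colProj hV h2))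
  have h1' := measurable_vec_iff.1 h1
  simp only [Matrix.mulVec, dotProduct, Matrix.transpose_apply]
  fun_prop

lemma _root_.measurable_invAbs {κ : Type} (δ : ℝ) {lam : Ω → κ → ℝ} {i : κ}
    (h : Measurable fun ω => lam ω i) : Measurable fun ω => invAbs δ (lam ω) i := by
  unfold invAbs
  refine Measurable.const_div (Measurable.ite (measurableSet_lt ?_ measurable_const) ?_ ?_) 1 <;>
  · simp only [← Real.norm_eq_abs]
    fun_prop

variable (hF : Measurable (Function.uncurry A.F)) (hd : ∀ x, Differentiable ℝ fun θ => A.F θ x)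
include hF

lemma measurable_batchLoss (t : ℕ) : Measurable (Function.uncurry
    fun (θ : Vec n) (x : Fin (A.batchSize t) → Vec d) =>
      (1 / (A.batchSize t : ℝ)) * ∑ i, A.F θ (x i)) := by
  refine (Finset.measurable_sum _ fun i _ => ?_).const_mul _
  exact hF.comp (measurable_fst.prodMk ((measurable_pi_apply i).comp measurable_snd))

include hd

lemma measurable_gradient_batchLoss {b : Ω → A.Batches} {t : ℕ}
    (hb : ∀ i, Measurable fun ω => b ω t i) {θ : Ω → Vec n} (hθ : Measurable θ) :
    Measurable fun ω => gradient (A.batchLoss (b ω) t) (θ ω) := by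
  have h := measurable_gradient_of_measurable_uncurry (measurable_batchLoss hF t)
    (fun y => (Differentiable.fun_sum fun i _ => hd (y i)).const_mul _)
  have hc := h.comp (hθ.prodMk (measurable_pi_iff.2 hb))
  simp only [Function.comp_def] at hc
  exact hc

variable (hd' : ∀ x, Differentiable ℝ (gradient fun θ => A.F θ x))
include hd'

lemma measurable_hessianMatrix_batchLoss {b : Ω → A.Batches} {t : ℕ}
    (hb : ∀ i, Measurable fun ω => b ω t i) {θ : Ω → Vec n} (hθ : Measurable θ) :
    Measurable fun ω => fun i j => hessianMatrix (A.batchLoss (b ω) t) (θ ω) i j := by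
  have h := measurable_hessianMatrix_of_measurable_uncurry (measurable_batchLoss hF t)
    (fun y => (Differentiable.fun_sum fun i _ => hd (y i)).const_mul _)
    (fun y => differentiable_gradient_const_mul_sum (fun i => hd (y i)) (fun i => hd' (y i)) _)
  have hc := h.comp (hθ.prodMk (measurable_pi_iff.2 hb))
  simp only [Function.comp_def] at hc
  exact hc

/-- The condition `A.eseBatch t < t` enters here: the new `V` and `u` depend on earlier batches
only, and so remain independent of the current one. -/
lemma measurableState_runESE {b : Ω → A.Batches} {t : ℕ}
    (hese : A.IsESETime t → A.eseBatch t < t)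
    (hb : ∀ s < t, ∀ i, Measurable fun ω => b ω s i) {s : Ω → FOSIState n k l t}
    (hs : MeasurableState s) : MeasurableState fun ω => A.runESE (b ω) t (s ω) := by
  by_cases ht : A.IsESETime t
  · have hH := measurable_hessianMatrix_batchLoss hF hd hd' (hb _ (hese ht)) hs.θ
    simp only [runESE, if_pos ht]
    exact ⟨hs.θ,
      fun i => measurable_invAbs _ ((measurable_pi_apply i).comp
        ((A.ese t).measurable_eigval.comp hH)),
      fun i j => (measurable_pi_apply j).comp ((measurable_pi_apply i).comp
        ((A.ese t).measurable_eigvec.comp hH)), hs.hist⟩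
  · simpa only [runESE, if_neg ht] using hs

lemma measurableState_step {b : Ω → A.Batches} {t : ℕ}
    (hese : A.IsESETime t → A.eseBatch t < t)
    (hb : ∀ s < t + 1, ∀ i, Measurable fun ω => b ω s i) {s : Ω → FOSIState n k l t}
    (hs : MeasurableState s) : MeasurableState fun ω => A.step (b ω) t (s ω) := by
  have hs' := measurableState_runESE hF hd hd' hese (fun r hr => hb r (by omega)) hs
  have hg := measurable_gradient_batchLoss hF hd (hb t (by omega)) hs'.θ
  have hp := measurable_pi_iff.1 ((A.baseOpt.measurable_prec t).comp hs'.hist)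
  refine ⟨?_, hs'.u, hs'.V, ?_⟩
  · simp only [step, updateStep_eq]
    have h1 := measurable_stepDir hp hs'.V hs'.u hg
    exact hs'.θ.sub (h1.const_smul (A.stepSize t))
  · simp only [step]
    refine measurable_pi_iff.2 fun r => ?_
    refine Fin.lastCases ?_ (fun r => ?_) r
    · simp only [Fin.snoc_last]
      exact hg.sub (measurable_colProj hs'.V hg)
    · simp only [Fin.snoc_castSucc]
      exact measurable_pi_iff.1 hs'.hist r

/-- The σ-algebra on `Ω` is arbitrary and only batches before `t` are assumed measurable. Taking the
σ-algebra generated by those batches shows that the run is adapted. -/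
lemma measurableState_state {b : Ω → A.Batches} (hese : ∀ t, A.IsESETime t → A.eseBatch t < t)
    (t : ℕ) (hb : ∀ s < t, ∀ i, Measurable fun ω => b ω s i) :
    MeasurableState fun ω => A.state (b ω) t := by
  induction t with
  | zero =>
    exact ⟨measurable_const, fun _ => measurable_const, fun _ _ => measurable_const,
      measurable_const⟩
  | succ t ih =>
    exact measurableState_step hF hd hd' (hese t) hb (ih fun s hs => hb s (by omega))

lemma measurable_iterate {b : Ω → A.Batches} (hese : ∀ t, A.IsESETime t → A.eseBatch t < t)
    (t : ℕ) (hb : ∀ s < t, ∀ i, Measurable fun ω => b ω s i) :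
    Measurable fun ω => A.iterate (b ω) t :=
  (measurableState_state hF hd hd' hese t hb).θ

end Measurability

end FOSI

/-! ### The direction of an iteration -/

/-- The columns of `V̂` are orthonormal or zero, and the entries of `u` belonging to nonzero columns
are bounded from above and below. -/
structure IsBoundedSpectrum {n : ℕ} {κ : Type} [Fintype κ] (z δ : ℝ) (V : Matrix (Fin n) κ ℝ)
    (u : κ → ℝ) : Prop where
  proj : V.transpose * V * V.transpose = V.transpose
  mem_Icc : ∀ i, u i ∈ Set.Icc (1 / max z (2 * δ)) (1 / δ) ∨ ∀ j, V j i = 0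

namespace FOSI

variable {n d k l : ℕ} {A : FOSI n d k l}

lemma runESE_θ (b : A.Batches) (t : ℕ) (s : FOSIState n k l t) : (A.runESE b t s).θ = s.θ := by
  unfold runESE; split_ifs <;> rfl

lemma runESE_hist (b : A.Batches) (t : ℕ) (s : FOSIState n k l t) :
    (A.runESE b t s).hist = s.hist := by
  unfold runESE; split_ifs <;> rfl

/-- The direction of iteration `t`, as a function of the gradient. -/
noncomputable def dir (A : FOSI n d k l) (b : A.Batches) (t : ℕ) (g : Vec n) : Vec n :=
  stepDir (A.precDiag b t) (A.runESE b t (A.state b t)).V (A.runESE b t (A.state b t)).u g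

lemma iterate_succ (b : A.Batches) (t : ℕ) :
    A.iterate b (t + 1) = A.iterate b t
      - A.stepSize t • A.dir b t (gradient (A.batchLoss b t) (A.iterate b t)) := by
  simp only [iterate, state, step, updateStep_eq, runESE_θ, runESE_hist, dir, precDiag]

lemma measurable_dir {Ω : Type*} {m : MeasurableSpace Ω} (hF : Measurable (Function.uncurry A.F))
    (hd : ∀ x, Differentiable ℝ fun θ => A.F θ x)
    (hd' : ∀ x, Differentiable ℝ (gradient fun θ => A.F θ x)) {b : Ω → A.Batches}
    (hese : ∀ t, A.IsESETime t → A.eseBatch t < t) {t : ℕ}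
    (hb : ∀ s < t, ∀ i, Measurable fun ω => b ω s i) {g : Ω → Vec n} (hg : Measurable g) :
    Measurable fun ω => A.dir (b ω) t (g ω) := by
  have hs := measurableState_state hF hd hd' hese t hb
  have hs' := measurableState_runESE hF hd hd' (hese t) hb hs
  exact measurable_stepDir
    (measurable_pi_iff.1 ((A.baseOpt.measurable_prec t).comp hs.hist)) hs'.V hs'.u hg

section Spectrum

variable {z δ : ℝ} (hδ : 0 < δ) (hkl : k + l ≤ n) (hbatch : ∀ t, 1 ≤ A.batchSize t)
  (hdamp : A.damping = δ) (hd : ∀ x, Differentiable ℝ fun θ => A.F θ x)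
  (hd' : ∀ x, Differentiable ℝ (gradient fun θ => A.F θ x))
  (hz : ∀ θ x, ‖hessian (fun θ' => A.F θ' x) θ‖ ≤ z)
include hδ hkl hbatch hdamp hd hd' hz

/-- The batch Hessian is symmetric, so the ESE specification applies to it; it has norm at most `z`,
and so do its Ritz values. -/
lemma isBoundedSpectrum_runESE (b : A.Batches) (t : ℕ) {s : FOSIState n k l t}
    (hs : IsBoundedSpectrum z δ s.V s.u) :
    IsBoundedSpectrum z δ (A.runESE b t s).V (A.runESE b t s).u := by
  unfold runESE
  split_ifs with ht
  · have hsymm := hessianMatrix_isSymm (differentiable_batchLoss hd b (A.eseBatch t))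
      (differentiable_gradient_batchLoss hd hd' b (A.eseBatch t)) s.θ
    obtain ⟨hV, hlam⟩ := ((A.ese t).isOutput _ hsymm).orthonormal_and_rayleigh hkl
    refine ⟨?_, fun i => Or.inl ?_⟩
    · simp only [hV, Matrix.one_mul]
    · simp only [hdamp]
      refine invAbs_mem_Icc hδ ?_
      rw [hlam]
      exact abs_rayleigh_hessianMatrix_le
        (norm_hessian_batchLoss_le hd hd' hz (hbatch _) b s.θ) hV i
  · exact hs

lemma isBoundedSpectrum_state (b : A.Batches) (t : ℕ) :
    IsBoundedSpectrum z δ (A.state b t).V (A.state b t).u := by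
  induction t with
  -- Initially `u = 0` is outside the interval, but all columns of `V` vanish.
  | zero => exact ⟨by simp [state], fun i => Or.inr fun j => rfl⟩
  | succ t ih => exact isBoundedSpectrum_runESE hδ hkl hbatch hdamp hd hd' hz b t ih

variable {ρ : ℝ} (hρ : 0 < ρ) {b : A.Batches} {t : ℕ}
  (hp : ∀ j, ρ ≤ A.precDiag b t j ∧ A.precDiag b t j ≤ z)

lemma inner_dir_comm (g h : Vec n) : inner ℝ h (A.dir b t g) = inner ℝ (A.dir b t h) g :=
  inner_stepDir_comm (isBoundedSpectrum_runESE hδ hkl hbatch hdamp hd hd' hz b t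
    (isBoundedSpectrum_state hδ hkl hbatch hdamp hd hd' hz b t)).proj _ _ _ _

include hρ hp

lemma le_inner_dir (g : Vec n) :
    1 / max z (2 * δ) * ‖g‖ ^ 2 ≤ inner ℝ g (A.dir b t g) := by
  have h := isBoundedSpectrum_runESE hδ hkl hbatch hdamp hd hd' hz b t
    (isBoundedSpectrum_state hδ hkl hbatch hdamp hd hd' hz b t)
  refine le_inner_stepDir h.proj (fun j => ?_) (fun i => (h.mem_Icc i).imp (fun h => h.1) id) g
  rw [← one_div]
  exact one_div_le_one_div_of_le (hρ.trans_le (hp j).1) (le_max_of_le_left (hp j).2)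

lemma norm_dir_le (g : Vec n) : ‖A.dir b t g‖ ≤ max (1 / δ) (1 / ρ) * ‖g‖ := by
  have h := isBoundedSpectrum_runESE hδ hkl hbatch hdamp hd hd' hz b t
    (isBoundedSpectrum_state hδ hkl hbatch hdamp hd hd' hz b t)
  refine norm_stepDir_le h.proj (by positivity) (fun j => ?_)
    (fun i => (h.mem_Icc i).imp (fun h => ?_) id) g
  · have hj := hρ.trans_le (hp j).1
    rw [abs_of_pos (inv_pos.2 hj), ← one_div]
    exact le_max_of_le_right (one_div_le_one_div_of_le hρ (hp j).1)
  · have h0 : 0 < 1 / max z (2 * δ) := by positivity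
    rw [abs_of_pos (h0.trans_le h.1)]
    exact le_max_of_le_left h.2

end Spectrum

end FOSI

/-- The decrease of a smooth function along a noisy preconditioned gradient step. -/
lemma LSmooth.descent {n : ℕ} {L : ℝ≥0} {f : Vec n → ℝ} (hf : LSmooth L f) {P : Vec n → Vec n}
    {a K η : ℝ} (hη : 0 ≤ η) (hK : 0 ≤ K)
    (hP : ∀ h g, inner ℝ h (P g) = inner ℝ (P h) g) (ha : ∀ g, a * ‖g‖ ^ 2 ≤ inner ℝ g (P g))
    (hPK : ∀ g, ‖P g‖ ≤ K * ‖g‖) (θ g : Vec n) :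
    f (θ - η • P g) ≤ f θ - a * η * ‖∇ f θ‖ ^ 2 - η * inner ℝ (P (∇ f θ)) (g - ∇ f θ)
      + 2 * L * K ^ 2 * η ^ 2 * (‖∇ f θ‖ ^ 2 + ‖g - ∇ f θ‖ ^ 2) := by
  have h := hf.le_add_inner θ (θ - η • P g)
  rw [sub_sub_cancel_left, inner_neg_right, norm_neg, inner_smul_right, norm_smul, mul_pow,
    Real.norm_of_nonneg hη, hP] at h
  -- Symmetry has moved `P` onto `∇ f θ`, so the noise is paired with a vector that does not involve
  -- the current batch.
  have h1 : inner ℝ (P (∇ f θ)) g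
      = inner ℝ (∇ f θ) (P (∇ f θ)) + inner ℝ (P (∇ f θ)) (g - ∇ f θ) := by
    rw [hP (∇ f θ), inner_sub_right]; ring
  have h2 : ‖P g‖ ^ 2 ≤ K ^ 2 * (2 * (‖∇ f θ‖ ^ 2 + ‖g - ∇ f θ‖ ^ 2)) := by
    have e1 : ‖g‖ ≤ ‖∇ f θ‖ + ‖g - ∇ f θ‖ := by
      simpa using norm_add_le (∇ f θ) (g - ∇ f θ)
    calc ‖P g‖ ^ 2 ≤ (K * (‖∇ f θ‖ + ‖g - ∇ f θ‖)) ^ 2 := by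
          have := hPK g
          gcongr
          exact this.trans (by gcongr)
      _ ≤ _ := by
          rw [mul_pow]
          gcongr
          nlinarith [sq_nonneg (‖∇ f θ‖ - ‖g - ∇ f θ‖)]
  have h3 : (L : ℝ) * (η ^ 2 * ‖P g‖ ^ 2)
      ≤ L * (η ^ 2 * (K ^ 2 * (2 * (‖∇ f θ‖ ^ 2 + ‖g - ∇ f θ‖ ^ 2)))) := by gcongr
  have h4 := mul_le_mul_of_nonneg_left (ha (∇ f θ)) hη
  rw [h1] at h
  linarith

/-! ### Noise independent of the past -/

lemma integrable_inner_of_memLp {Ω : Type*} [MeasurableSpace Ω] {μ : Measure Ω} {n : ℕ}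
    {v w : Ω → Vec n} (hv : MemLp v 2 μ) (hw : MemLp w 2 μ) :
    Integrable (fun ω => inner ℝ (v ω) (w ω)) μ := by
  refine (hv.integrable_norm_pow (by norm_num) |>.add
    (hw.integrable_norm_pow (by norm_num))).mono' (hv.1.inner hw.1) ?_
  refine Filter.Eventually.of_forall fun ω => ?_
  refine (norm_inner_le_norm _ _).trans ?_
  simp only [Pi.add_apply]
  nlinarith [sq_nonneg (‖v ω‖ - ‖w ω‖), norm_nonneg (v ω), norm_nonneg (w ω)]

section Noise

variable {Ω : Type*} [MeasurableSpace Ω] {μ : Measure Ω} [IsProbabilityMeasure μ]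
  {S S' : Type*} [MeasurableSpace S] [MeasurableSpace S'] {D : Measure S} [IsProbabilityMeasure D]
  {n : ℕ}

variable {Y : Ω → S'} {x : Ω → S} (hY : Measurable Y) (hx : Measurable x) (hD : μ.map x = D)
  (hind : IndepFun Y x μ) {ψ : S' × S → Vec n} (hψ : Measurable ψ) {σ : ℝ}
  (hσ : ∀ᵐ ω ∂μ, ∫⁻ s, ‖ψ (Y ω, s)‖ₑ ^ 2 ∂D ≤ ENNReal.ofReal (σ ^ 2))

include hY hx hD hind hψ hσ

/-- By independence the joint law is a product, and Tonelli reduces the claim to the conditional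
bound at fixed `Y ω`. Square integrability of the noise is then a consequence, not an assumption. -/
lemma lintegral_noise_le : ∫⁻ ω, ‖ψ (Y ω, x ω)‖ₑ ^ 2 ∂μ ≤ ENNReal.ofReal (σ ^ 2) := by
  have hmap := (indepFun_iff_map_prod_eq_prod_map_map hY.aemeasurable hx.aemeasurable).1 hind
  rw [hD] at hmap
  have hm : Measurable fun q => ‖ψ q‖ₑ ^ 2 := hψ.enorm.pow_const 2
  have := Measure.isProbabilityMeasure_map (μ := μ) hY.aemeasurable
  calc ∫⁻ ω, ‖ψ (Y ω, x ω)‖ₑ ^ 2 ∂μ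
      = ∫⁻ q, ‖ψ q‖ₑ ^ 2 ∂(μ.map fun ω => (Y ω, x ω)) := by
        rw [lintegral_map hm (hY.prodMk hx)]
    _ = ∫⁻ ω, ∫⁻ s, ‖ψ (Y ω, s)‖ₑ ^ 2 ∂D ∂μ := by
        rw [hmap, lintegral_prod _ hm.aemeasurable, lintegral_map hm.lintegral_prod_right' hY]
    _ ≤ ∫⁻ _, ENNReal.ofReal (σ ^ 2) ∂μ := lintegral_mono_ae hσ
    _ = _ := by simp

lemma memLp_noise : MemLp (fun ω => ψ (Y ω, x ω)) 2 μ := by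
  have hm : Measurable fun ω => ψ (Y ω, x ω) := hψ.comp (hY.prodMk hx)
  refine ⟨hm.aestronglyMeasurable, ?_⟩
  rw [eLpNorm_lt_top_iff_lintegral_rpow_enorm_lt_top (by norm_num) (by norm_num)]
  have := (lintegral_noise_le hY hx hD hind hψ hσ).trans_lt ENNReal.ofReal_lt_top
  simpa using this

lemma integral_norm_noise_sq_le : ∫ ω, ‖ψ (Y ω, x ω)‖ ^ 2 ∂μ ≤ σ ^ 2 := by
  have hm : Measurable fun ω => ψ (Y ω, x ω) := hψ.comp (hY.prodMk hx)
  rw [integral_eq_lintegral_of_nonneg_ae (Filter.Eventually.of_forall fun _ => by positivity)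
    (hm.norm.pow_const 2).aestronglyMeasurable]
  refine ENNReal.toReal_le_of_le_ofReal (sq_nonneg σ) ?_
  have := lintegral_noise_le hY hx hD hind hψ hσ
  simpa [ENNReal.ofReal_pow, ofReal_norm] using this

/-- Fubini on the product law: with `Y ω` frozen, `w (Y ω)` is constant and comes out of the
integral over the sample, which leaves the zero mean. -/
lemma integral_inner_noise {w : S' → Vec n} (hw : Measurable w)
    (hwL : MemLp (fun ω => w (Y ω)) 2 μ) (h0 : ∀ᵐ ω ∂μ, ∫ s, ψ (Y ω, s) ∂D = 0) :
    ∫ ω, inner ℝ (w (Y ω)) (ψ (Y ω, x ω)) ∂μ = 0 := by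
  have hmap := (indepFun_iff_map_prod_eq_prod_map_map hY.aemeasurable hx.aemeasurable).1 hind
  rw [hD] at hmap
  have hint := integrable_inner_of_memLp hwL (memLp_noise hY hx hD hind hψ hσ)
  have hm : Measurable fun q : S' × S => inner ℝ (w q.1) (ψ q) :=
    (hw.comp measurable_fst).inner hψ
  have := Measure.isProbabilityMeasure_map (μ := μ) hY.aemeasurable
  have hint' : Integrable (fun q : S' × S => inner ℝ (w q.1) (ψ q)) ((μ.map Y).prod D) := by
    rw [← hmap, integrable_map_measure hm.aestronglyMeasurable (hY.prodMk hx).aemeasurable]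
    exact hint
  calc ∫ ω, inner ℝ (w (Y ω)) (ψ (Y ω, x ω)) ∂μ
      = ∫ q, inner ℝ (w q.1) (ψ q) ∂(μ.map fun ω => (Y ω, x ω)) := by
        rw [integral_map (hY.prodMk hx).aemeasurable hm.aestronglyMeasurable]
    _ = ∫ ω, ∫ s, inner ℝ (w (Y ω)) (ψ (Y ω, s)) ∂D ∂μ := by
        rw [hmap, integral_prod _ hint', integral_map hY.aemeasurable
          hint'.aestronglyMeasurable.integral_prod_right']
    _ = ∫ _, (0 : ℝ) ∂μ := by
        refine integral_congr_ae ?_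
        filter_upwards [hσ, h0] with ω h1 h2
        have hψω : Measurable fun s => ψ (Y ω, s) := hψ.comp measurable_prodMk_left
        have hL : MemLp (fun s => ψ (Y ω, s)) 2 D := by
          refine ⟨hψω.aestronglyMeasurable, ?_⟩
          rw [eLpNorm_lt_top_iff_lintegral_rpow_enorm_lt_top (by norm_num) (by norm_num)]
          simpa using h1.trans_lt ENNReal.ofReal_lt_top
        have hI : Integrable (fun s => ψ (Y ω, s)) D := hL.integrable (by norm_num)
        rw [integral_inner hI, h2, inner_zero_right]
    _ = 0 := by simp

end Noise

namespace FOSI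

variable {n d k l : ℕ}

/-! ### One iteration in expectation -/

/-- The standing assumptions on a run of FOSI on random samples, with the step sizes left free. -/
structure IsRun (A : FOSI n d k l) (L : ℝ≥0) (σ z δ ρ flow : ℝ) (D : Measure (Vec d))
    {Ω : Type*} [MeasurableSpace Ω] (μ : Measure Ω)
    (X : (t : ℕ) → Fin (A.batchSize t) → Ω → Vec d) : Prop where
  damping_pos : 0 < δ
  prec_pos : 0 < ρ
  smooth_pos : 0 < L
  rank_le : k + l ≤ n
  batchSize_pos : ∀ t, 1 ≤ A.batchSize t
  damping_eq : A.damping = δ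
  stepSize_nonneg : ∀ t, 0 ≤ A.stepSize t
  eseBatch_lt : ∀ t, A.IsESETime t → A.eseBatch t < t
  measurable_loss : Measurable (Function.uncurry A.F)
  differentiable_loss : ∀ x, Differentiable ℝ fun θ => A.F θ x
  differentiable_gradient_loss : ∀ x, Differentiable ℝ (gradient fun θ => A.F θ x)
  measurable_sample : ∀ t i, Measurable (X t i)
  map_sample : ∀ t i, μ.map (X t i) = D
  indep_sample : iIndepFun (fun (p : (t : ℕ) × Fin (A.batchSize t)) => X p.1 p.2) μ
  smooth : LSmooth L (A.objective D)
  low_le : ∀ θ, flow ≤ A.objective D θ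
  noise : ∀ t, ∀ᵐ ω ∂μ,
    let θ := A.iterate (fun s i => X s i ω) t
    ∫ x, gradient (fun θ' => A.F θ' x) θ ∂D = gradient (A.objective D) θ ∧
    ∫⁻ x, ‖gradient (fun θ' => A.F θ' x) θ - gradient (A.objective D) θ‖ₑ ^ 2 ∂D
      ≤ ENNReal.ofReal (σ ^ 2)
  hessian_le : ∀ θ x, ‖hessian (fun θ' => A.F θ' x) θ‖ ≤ z
  prec_bounds : ∀ t, ∀ᵐ ω ∂μ, ∀ j, ρ ≤ A.precDiag (fun s i => X s i ω) t j ∧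
    A.precDiag (fun s i => X s i ω) t j ≤ z

namespace IsRun

variable {A : FOSI n d k l} {L : ℝ≥0} {σ z δ ρ flow : ℝ} {D : Measure (Vec d)}
  [IsProbabilityMeasure D] {Ω : Type*} [mΩ : MeasurableSpace Ω] {μ : Measure Ω}
  [IsProbabilityMeasure μ] {X : (t : ℕ) → Fin (A.batchSize t) → Ω → Vec d}

/-- The σ-algebra generated by the batches of the iterations before `t`. -/
@[reducible]
def past (X : (t : ℕ) → Fin (A.batchSize t) → Ω → Vec d) (t : ℕ) : MeasurableSpace Ω :=
  ⨆ p ∈ {p : (t : ℕ) × Fin (A.batchSize t) | p.1 < t},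
    MeasurableSpace.comap (X p.1 p.2) inferInstance

variable (h : A.IsRun L σ z δ ρ flow D μ X)
include h

omit [IsProbabilityMeasure D] [IsProbabilityMeasure μ]

lemma past_le (t : ℕ) : past X t ≤ mΩ :=
  iSup₂_le fun p _ => (h.measurable_sample p.1 p.2).comap_le

omit mΩ h in
lemma measurable_sample_past {s t : ℕ} (hs : s < t) (i : Fin (A.batchSize s)) :
    Measurable[past X t] (X s i) :=
  Measurable.of_comap_le (le_iSup₂_of_le (f := fun (p : (t : ℕ) × Fin (A.batchSize t)) _ =>
    MeasurableSpace.comap (X p.1 p.2) inferInstance) ⟨s, i⟩ hs le_rfl)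

lemma measurable_iterate_past (t : ℕ) :
    Measurable[past X t] fun ω => A.iterate (fun s i => X s i ω) t :=
  FOSI.measurable_iterate h.measurable_loss h.differentiable_loss h.differentiable_gradient_loss
    h.eseBatch_lt t fun _ hs i => measurable_sample_past hs i

lemma measurable_iterate (t : ℕ) : Measurable fun ω => A.iterate (fun s i => X s i ω) t :=
  (h.measurable_iterate_past t).mono (h.past_le t) le_rfl

lemma continuous_gradient : Continuous (gradient (A.objective D)) := h.smooth.2.continuous

lemma measurable_dir_gradient_past (t : ℕ) :
    Measurable[past X t] fun ω => A.dir (fun s i => X s i ω) t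
      (gradient (A.objective D) (A.iterate (fun s i => X s i ω) t)) :=
  measurable_dir h.measurable_loss h.differentiable_loss h.differentiable_gradient_loss
    h.eseBatch_lt (fun _ hs i => measurable_sample_past hs i)
    (h.continuous_gradient.measurable.comp (h.measurable_iterate_past t))

/-- The indices before `t` and the single index `(t, i)` are disjoint, so the σ-algebras they
generate are independent. -/
lemma indepFun_past {S : Type*} [MeasurableSpace S] {t : ℕ} {Y : Ω → S}
    (hY : Measurable[past X t] Y) (i : Fin (A.batchSize t)) : IndepFun Y (X t i) μ := by
  have hdisj : Disjoint {p : (t : ℕ) × Fin (A.batchSize t) | p.1 < t} {⟨t, i⟩} := by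
    simp
  have hi := indep_iSup_of_disjoint
    (fun p : (t : ℕ) × Fin (A.batchSize t) => (h.measurable_sample p.1 p.2).comap_le)
    h.indep_sample hdisj
  rw [IndepFun_iff_Indep]
  refine indep_of_indep_of_le_left (indep_of_indep_of_le_right hi ?_) hY.comap_le
  simp

/-- The gradient noise of the batch of iteration `t`. -/
noncomputable def noiseAt (A : FOSI n d k l) (D : Measure (Vec d))
    (X : (t : ℕ) → Fin (A.batchSize t) → Ω → Vec d) (t : ℕ) (ω : Ω) : Vec n :=
  gradient (A.batchLoss (fun s i => X s i ω) t) (A.iterate (fun s i => X s i ω) t)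
    - gradient (A.objective D) (A.iterate (fun s i => X s i ω) t)

/-- The gradient noise of a single sample of iteration `t`. -/
noncomputable def sampleNoise (A : FOSI n d k l) (D : Measure (Vec d))
    (X : (t : ℕ) → Fin (A.batchSize t) → Ω → Vec d) (t : ℕ) (i : Fin (A.batchSize t)) (ω : Ω) :
    Vec n :=
  gradient (fun θ' => A.F θ' (X t i ω)) (A.iterate (fun s i => X s i ω) t)
    - gradient (A.objective D) (A.iterate (fun s i => X s i ω) t)

lemma noiseAt_eq (t : ℕ) (ω : Ω) :
    noiseAt A D X t ω = (1 / (A.batchSize t : ℝ)) • ∑ i, sampleNoise A D X t i ω := by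
  have ht : (A.batchSize t : ℝ) ≠ 0 := by
    have := h.batchSize_pos t
    positivity
  simp only [noiseAt, sampleNoise]
  rw [gradient_batchLoss h.differentiable_loss, Finset.sum_sub_distrib, smul_sub]
  congr 1
  rw [Finset.sum_const, Finset.card_univ, Fintype.card_fin, ← Nat.cast_smul_eq_nsmul ℝ, smul_smul,
    one_div, inv_mul_cancel₀ ht, one_smul]

/-- Cauchy–Schwarz only: the variance gain `1 / m_t` of averaging is given up, and independence
within a batch plays no role. -/
lemma norm_noiseAt_sq_le (t : ℕ) (ω : Ω) :
    ‖noiseAt A D X t ω‖ ^ 2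
      ≤ (1 / (A.batchSize t : ℝ)) * ∑ i, ‖sampleNoise A D X t i ω‖ ^ 2 := by
  have ht : (0 : ℝ) < A.batchSize t := by exact_mod_cast h.batchSize_pos t
  rw [h.noiseAt_eq, norm_smul, mul_pow, Real.norm_of_nonneg (by positivity), sq (1 / _), mul_assoc]
  gcongr
  rw [one_div, inv_mul_le_iff₀ ht]
  calc ‖∑ i, sampleNoise A D X t i ω‖ ^ 2 ≤ (∑ i, ‖sampleNoise A D X t i ω‖) ^ 2 := by
        gcongr
        exact norm_sum_le _ _
    _ ≤ _ := by
        simpa using sq_sum_le_card_mul_sum_sq (s := Finset.univ)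
          (f := fun i => ‖sampleNoise A D X t i ω‖)

lemma measurable_noise : Measurable fun q : (Vec n × Vec n) × Vec d =>
    gradient (fun θ' => A.F θ' q.2) q.1.1 - gradient (A.objective D) q.1.1 :=
  ((measurable_gradient_of_measurable_uncurry h.measurable_loss h.differentiable_loss).comp
    (measurable_fst.fst.prodMk measurable_snd)).sub
    (h.continuous_gradient.measurable.comp measurable_fst.fst)

lemma ae_integral_sampleNoise [IsProbabilityMeasure D] (t : ℕ) : ∀ᵐ ω ∂μ,
    ∫ x, (gradient (fun θ' => A.F θ' x) (A.iterate (fun s i => X s i ω) t)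
      - gradient (A.objective D) (A.iterate (fun s i => X s i ω) t)) ∂D = 0 := by
  filter_upwards [h.noise t] with ω ⟨h1, h2⟩
  set θ := A.iterate (fun s i => X s i ω) t
  have hm : Measurable fun x => gradient (fun θ' => A.F θ' x) θ :=
    (measurable_gradient_of_measurable_uncurry h.measurable_loss h.differentiable_loss).comp
      measurable_prodMk_left
  -- The variance bound yields integrability; without it the Bochner integral in `h1` could be a
  -- default `0` and the difference could not be split.
  have hL : MemLp (fun x => gradient (fun θ' => A.F θ' x) θ - gradient (A.objective D) θ) 2 D := by
    refine ⟨(hm.sub_const _).aestronglyMeasurable, ?_⟩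
    rw [eLpNorm_lt_top_iff_lintegral_rpow_enorm_lt_top (by norm_num) (by norm_num)]
    simpa using h2.trans_lt ENNReal.ofReal_lt_top
  have hI : Integrable (fun x => gradient (fun θ' => A.F θ' x) θ) D := by
    refine ((hL.integrable (by norm_num)).add
      (integrable_const (gradient (A.objective D) θ))).congr ?_
    exact Filter.Eventually.of_forall fun x => sub_add_cancel _ _
  rw [integral_sub hI (integrable_const _), h1]
  simp

/-- `‖∇f‖²` is dominated by `4 L (f - flow)`, so integrability of the objective along the run is the
only induction hypothesis needed. -/
lemma integrable_norm_gradient_sq {t : ℕ} [IsProbabilityMeasure μ]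
    (hf : Integrable (fun ω => A.objective D (A.iterate (fun s i => X s i ω) t)) μ) :
    Integrable (fun ω =>
      ‖gradient (A.objective D) (A.iterate (fun s i => X s i ω) t)‖ ^ 2) μ := by
  refine ((hf.sub (integrable_const flow)).const_mul (4 * L : ℝ)).mono'
    ((h.continuous_gradient.measurable.comp
      (h.measurable_iterate t)).norm.pow_const 2).aestronglyMeasurable ?_
  refine Filter.Eventually.of_forall fun ω => ?_
  rw [Real.norm_of_nonneg (by positivity)]
  exact h.smooth.norm_gradient_sq_le h.smooth_pos h.low_le _

lemma memLp_gradient {t : ℕ} [IsProbabilityMeasure μ]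
    (hf : Integrable (fun ω => A.objective D (A.iterate (fun s i => X s i ω) t)) μ) :
    MemLp (fun ω => gradient (A.objective D) (A.iterate (fun s i => X s i ω) t)) 2 μ :=
  (memLp_two_iff_integrable_sq_norm (h.continuous_gradient.measurable.comp
    (h.measurable_iterate t)).aestronglyMeasurable).2 (h.integrable_norm_gradient_sq hf)

lemma memLp_dir_gradient {t : ℕ} [IsProbabilityMeasure μ]
    (hf : Integrable (fun ω => A.objective D (A.iterate (fun s i => X s i ω) t)) μ) :
    MemLp (fun ω => A.dir (fun s i => X s i ω) t
      (gradient (A.objective D) (A.iterate (fun s i => X s i ω) t))) 2 μ := by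
  refine (h.memLp_gradient hf).of_le_mul (c := max (1 / δ) (1 / ρ))
    ((h.measurable_dir_gradient_past t).mono (h.past_le t) le_rfl).aestronglyMeasurable ?_
  filter_upwards [h.prec_bounds t] with ω hp
  exact norm_dir_le h.damping_pos h.rank_le h.batchSize_pos h.damping_eq h.differentiable_loss
    h.differentiable_gradient_loss h.hessian_le h.prec_pos hp _

variable [IsProbabilityMeasure D] [IsProbabilityMeasure μ]

lemma sampleNoise_bounds {t : ℕ}
    (hf : Integrable (fun ω => A.objective D (A.iterate (fun s i => X s i ω) t)) μ)
    (i : Fin (A.batchSize t)) :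
    MemLp (sampleNoise A D X t i) 2 μ ∧ ∫ ω, ‖sampleNoise A D X t i ω‖ ^ 2 ∂μ ≤ σ ^ 2 ∧
      ∫ ω, inner ℝ (A.dir (fun s i => X s i ω) t
        (gradient (A.objective D) (A.iterate (fun s i => X s i ω) t)))
        (sampleNoise A D X t i ω) ∂μ = 0 := by
  -- The past enters as a pair: the noise reads its first component, and the second is the vector
  -- tested against it.
  have hY : Measurable[past X t] fun ω => (A.iterate (fun s i => X s i ω) t,
      A.dir (fun s i => X s i ω) t
        (gradient (A.objective D) (A.iterate (fun s i => X s i ω) t))) :=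
    (h.measurable_iterate_past t).prodMk (h.measurable_dir_gradient_past t)
  have hY' := hY.mono (h.past_le t) le_rfl
  have hind := h.indepFun_past hY i
  have hσ := (h.noise t).mono fun ω hω => hω.2
  exact ⟨memLp_noise hY' (h.measurable_sample t i) (h.map_sample t i) hind h.measurable_noise hσ,
    integral_norm_noise_sq_le hY' (h.measurable_sample t i) (h.map_sample t i) hind
      h.measurable_noise hσ,
    integral_inner_noise hY' (h.measurable_sample t i) (h.map_sample t i) hind
      h.measurable_noise hσ measurable_snd (h.memLp_dir_gradient hf)
      (h.ae_integral_sampleNoise t)⟩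

lemma noiseAt_bounds {t : ℕ}
    (hf : Integrable (fun ω => A.objective D (A.iterate (fun s i => X s i ω) t)) μ) :
    MemLp (noiseAt A D X t) 2 μ ∧ ∫ ω, ‖noiseAt A D X t ω‖ ^ 2 ∂μ ≤ σ ^ 2 ∧
      ∫ ω, inner ℝ (A.dir (fun s i => X s i ω) t
        (gradient (A.objective D) (A.iterate (fun s i => X s i ω) t)))
        (noiseAt A D X t ω) ∂μ = 0 := by
  have hs := fun i => h.sampleNoise_bounds hf i
  have ht : (0 : ℝ) < A.batchSize t := by exact_mod_cast h.batchSize_pos t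
  have hL : MemLp (noiseAt A D X t) 2 μ := by
    rw [funext (h.noiseAt_eq t)]
    exact (memLp_finsetSum Finset.univ fun i _ => (hs i).1).const_smul (1 / (A.batchSize t : ℝ))
  refine ⟨hL, ?_, ?_⟩
  · have hint : ∀ i, Integrable (fun ω => ‖sampleNoise A D X t i ω‖ ^ 2) μ :=
      fun i => (hs i).1.integrable_norm_pow (by norm_num)
    calc ∫ ω, ‖noiseAt A D X t ω‖ ^ 2 ∂μ
        ≤ ∫ ω, (1 / (A.batchSize t : ℝ)) * ∑ i, ‖sampleNoise A D X t i ω‖ ^ 2 ∂μ :=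
          integral_mono (hL.integrable_norm_pow (by norm_num))
            ((integrable_finsetSum _ fun i _ => hint i).const_mul _) (h.norm_noiseAt_sq_le t)
      _ = (1 / (A.batchSize t : ℝ)) * ∑ i, ∫ ω, ‖sampleNoise A D X t i ω‖ ^ 2 ∂μ := by
          rw [integral_const_mul, integral_finsetSum _ fun i _ => hint i]
      _ ≤ (1 / (A.batchSize t : ℝ)) * ∑ _i : Fin (A.batchSize t), σ ^ 2 := by
          gcongr with i _
          exact (hs i).2.1
      _ = σ ^ 2 := by simp; field_simp
  · simp only [h.noiseAt_eq, inner_smul_right, inner_sum]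
    rw [integral_const_mul, integral_finsetSum _ fun i _ =>
      integrable_inner_of_memLp (h.memLp_dir_gradient hf) (hs i).1]
    simp [(hs _).2.2]

/-- Integrability of the objective propagates along the run, and its expectation satisfies the
descent recursion. -/
lemma integrable_and_descent {t : ℕ}
    (hf : Integrable (fun ω => A.objective D (A.iterate (fun s i => X s i ω) t)) μ) :
    Integrable (fun ω => A.objective D (A.iterate (fun s i => X s i ω) (t + 1))) μ ∧
    ∫ ω, A.objective D (A.iterate (fun s i => X s i ω) (t + 1)) ∂μ
      ≤ ∫ ω, A.objective D (A.iterate (fun s i => X s i ω) t) ∂μ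
        - 1 / max z (2 * δ) * A.stepSize t
          * ∫ ω, ‖gradient (A.objective D) (A.iterate (fun s i => X s i ω) t)‖ ^ 2 ∂μ
        + 2 * L * max (1 / δ) (1 / ρ) ^ 2 * A.stepSize t ^ 2
          * (∫ ω, ‖gradient (A.objective D) (A.iterate (fun s i => X s i ω) t)‖ ^ 2 ∂μ
            + σ ^ 2) := by
  obtain ⟨hL, hsq, h0⟩ := h.noiseAt_bounds hf
  have hG := h.integrable_norm_gradient_sq hf
  have hN : Integrable (fun ω => ‖noiseAt A D X t ω‖ ^ 2) μ :=
    hL.integrable_norm_pow (by norm_num)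
  have hI := integrable_inner_of_memLp (h.memLp_dir_gradient hf) hL
  have hK : 0 ≤ max (1 / δ) (1 / ρ) :=
    (one_div_nonneg.2 h.damping_pos.le).trans (le_max_left _ _)
  set a := 1 / max z (2 * δ)
  set K := max (1 / δ) (1 / ρ)
  set η := A.stepSize t with hη
  have hae : ∀ᵐ ω ∂μ, A.objective D (A.iterate (fun s i => X s i ω) (t + 1))
      ≤ A.objective D (A.iterate (fun s i => X s i ω) t)
        - a * η * ‖gradient (A.objective D) (A.iterate (fun s i => X s i ω) t)‖ ^ 2
        - η * inner ℝ (A.dir (fun s i => X s i ω) t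
          (gradient (A.objective D) (A.iterate (fun s i => X s i ω) t))) (noiseAt A D X t ω)
        + 2 * L * K ^ 2 * η ^ 2
          * (‖gradient (A.objective D) (A.iterate (fun s i => X s i ω) t)‖ ^ 2
            + ‖noiseAt A D X t ω‖ ^ 2) := by
    filter_upwards [h.prec_bounds t] with ω hp
    rw [iterate_succ]
    exact h.smooth.descent (P := A.dir (fun s i => X s i ω) t) (h.stepSize_nonneg t) hK
      (fun v g => inner_dir_comm h.damping_pos h.rank_le h.batchSize_pos h.damping_eq
        h.differentiable_loss h.differentiable_gradient_loss h.hessian_le g v)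
      (le_inner_dir h.damping_pos h.rank_le h.batchSize_pos h.damping_eq h.differentiable_loss
        h.differentiable_gradient_loss h.hessian_le h.prec_pos hp)
      (norm_dir_le h.damping_pos h.rank_le h.batchSize_pos h.damping_eq h.differentiable_loss
        h.differentiable_gradient_loss h.hessian_le h.prec_pos hp) _ _
  have hB := ((hf.sub (hG.const_mul (a * η))).sub (hI.const_mul η)).add
    ((hG.add hN).const_mul (2 * L * K ^ 2 * η ^ 2))
  -- The new objective value lies between the constant `flow` and the integrable right-hand side of
  -- the descent inequality.
  have hf' : Integrable (fun ω => A.objective D (A.iterate (fun s i => X s i ω) (t + 1))) μ :=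
    integrable_of_le_of_le
      (h.smooth.1.continuous.measurable.comp (h.measurable_iterate (t + 1))).aestronglyMeasurable
      (Filter.Eventually.of_forall fun ω => h.low_le _) hae (integrable_const flow) hB
  refine ⟨hf', (integral_mono_ae hf' hB hae).trans ?_⟩
  rw [integral_add' ((hf.sub (hG.const_mul (a * η))).sub (hI.const_mul η))
      ((hG.add hN).const_mul (2 * L * K ^ 2 * η ^ 2)),
    integral_sub' (hf.sub (hG.const_mul (a * η))) (hI.const_mul η),
    integral_sub' hf (hG.const_mul (a * η)), integral_const_mul, integral_const_mul,
    integral_const_mul, h0, mul_zero, sub_zero]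
  have e : ∫ ω, ((fun ω => ‖gradient (A.objective D) (A.iterate (fun s i => X s i ω) t)‖ ^ 2)
      + fun ω => ‖noiseAt A D X t ω‖ ^ 2) ω ∂μ
      ≤ ∫ ω, ‖gradient (A.objective D) (A.iterate (fun s i => X s i ω) t)‖ ^ 2 ∂μ + σ ^ 2 := by
    rw [integral_add' hG hN]
    gcongr
  gcongr

lemma integrable_objective (t : ℕ) :
    Integrable (fun ω => A.objective D (A.iterate (fun s i => X s i ω) t)) μ := by
  induction t with
  | zero => exact integrable_const (A.objective D A.init)
  | succ t ih => exact (h.integrable_and_descent ih).1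

/-- The descent recursion for the expected suboptimality. -/
lemma gap_succ_le (t : ℕ) :
    ∫ ω, A.objective D (A.iterate (fun s i => X s i ω) (t + 1)) ∂μ - flow
      ≤ (1 + 8 * L ^ 2 * max (1 / δ) (1 / ρ) ^ 2 * A.stepSize t ^ 2)
          * (∫ ω, A.objective D (A.iterate (fun s i => X s i ω) t) ∂μ - flow)
        - 1 / max z (2 * δ) * A.stepSize t
          * ∫ ω, ‖gradient (A.objective D) (A.iterate (fun s i => X s i ω) t)‖ ^ 2 ∂μ
        + 2 * L * max (1 / δ) (1 / ρ) ^ 2 * σ ^ 2 * A.stepSize t ^ 2 := by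
  have hf := h.integrable_objective t
  have h1 := (h.integrable_and_descent hf).2
  -- Turns the second-order gradient term into a multiple of the gap; `2 L * 4 L` is the constant `8
  -- L ^ 2`.
  have h2 : ∫ ω, ‖gradient (A.objective D) (A.iterate (fun s i => X s i ω) t)‖ ^ 2 ∂μ
      ≤ 4 * L * (∫ ω, A.objective D (A.iterate (fun s i => X s i ω) t) ∂μ - flow) := by
    calc _ ≤ ∫ ω, 4 * L * (A.objective D (A.iterate (fun s i => X s i ω) t) - flow) ∂μ :=
          integral_mono (h.integrable_norm_gradient_sq hf)
            ((hf.sub (integrable_const flow)).const_mul _)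
            fun ω => h.smooth.norm_gradient_sq_le h.smooth_pos h.low_le _
      _ = _ := by
          rw [integral_const_mul, integral_sub hf (integrable_const _)]
          simp
  have h3 : 0 ≤ 2 * (L : ℝ) * max (1 / δ) (1 / ρ) ^ 2 * A.stepSize t ^ 2 := by positivity
  have h4 := mul_le_mul_of_nonneg_left h2 h3
  linarith

end IsRun

end FOSI

/-- Iterations are numbered from `0`, so `A.iterate b t` is the iterate `θ_{t+1}` of the numbering
from `1`, and the step size `c (t + 1) ^ (-β)` of iteration `t` is `c t ^ (-β)` there. -/
theorem lemma3 (L : ℝ≥0) (σ z δ ρ c β Δ : ℝ) (hσ : 0 < σ) (hz : 0 < z) (hδ : 0 < δ) (hρ : 0 < ρ)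
    (hc : 0 < c) (hβ : β ∈ Set.Ioo (1 / 2 : ℝ) 1) :
    ∃ C : ℝ, 0 < C ∧
      ∀ (n d k l : ℕ) (A : FOSI n d k l) (D : Measure (Vec d)) [IsProbabilityMeasure D]
        (Ω : Type*) [MeasurableSpace Ω] (μ : Measure Ω) [IsProbabilityMeasure μ]
        (X : (t : ℕ) → Fin (A.batchSize t) → Ω → Vec d) (flow : ℝ),
        -- the parameters of the algorithm
        k + l ≤ n → 1 ≤ A.T → (∀ t, 1 ≤ A.batchSize t) → A.damping = δ →
        (∀ t, A.stepSize t = c * ((t : ℝ) + 1) ^ (-β)) →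
        (∀ t, A.IsESETime t → A.eseBatch t < t) →
        -- `F` is twice differentiable with respect to `θ`, and `f(θ) = E_x [F(θ, x)]` exists
        Measurable (Function.uncurry A.F) →
        (∀ x, Differentiable ℝ (fun θ => A.F θ x)) →
        (∀ x, Differentiable ℝ (gradient fun θ => A.F θ x)) →
        (∀ θ, Integrable (A.F θ) D) →
        -- the samples are independent with distribution `D`
        (∀ t i, Measurable (X t i)) → (∀ t i, μ.map (X t i) = D) →
        iIndepFun (fun (p : (t : ℕ) × Fin (A.batchSize t)) => X p.1 p.2) μ →
        -- `f` is `L`-smooth and bounded below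
        LSmooth L (A.objective D) → (∀ θ, flow ≤ A.objective D θ) →
        A.objective D A.init - flow ≤ Δ →
        -- the stochastic gradients are unbiased with variance at most `σ ^ 2`
        (∀ t, ∀ᵐ ω ∂μ,
          let θ := A.iterate (fun s i => X s i ω) t
          ∫ x, gradient (fun θ' => A.F θ' x) θ ∂D = gradient (A.objective D) θ ∧
          ∫⁻ x, ‖gradient (fun θ' => A.F θ' x) θ - gradient (A.objective D) θ‖ₑ ^ 2 ∂D
            ≤ ENNReal.ofReal (σ ^ 2)) →
        -- bounded Hessians, and a bounded, uniformly positive definite preconditioner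
        (∀ θ x, ‖hessian (fun θ' => A.F θ' x) θ‖ ≤ z) →
        (∀ t, ∀ᵐ ω ∂μ, ∀ j, ρ ≤ A.precDiag (fun s i => X s i ω) t j ∧
          A.precDiag (fun s i => X s i ω) t j ≤ z) →
        (∀ t, Integrable (fun ω =>
          ‖gradient (A.objective D) (A.iterate (fun s i => X s i ω) t)‖ ^ 2) μ) ∧
        ∀ ε ∈ Set.Ioo (0 : ℝ) 1, ∀ N : ℕ, C * ε ^ (-(1 / (1 - β))) ≤ N →
          (1 / (N : ℝ)) * ∑ t ∈ Finset.range N,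
            ∫ ω, ‖gradient (A.objective D) (A.iterate (fun s i => X s i ω) t)‖ ^ 2 ∂μ ≤ ε := by
  have ha : 0 < 1 / max z (2 * δ) := one_div_pos.2 (hz.trans_le (le_max_left _ _))
  -- `L + 1` replaces `L`, which may be zero, since the gradient bound uses a step of length `1 / (2
  -- L)`. The constant is fixed before the dimension, the run and `flow`.
  obtain ⟨C, hC, hmain⟩ := exists_iteration_bound (a := 1 / max z (2 * δ))
    (K := 8 * ((L + 1 : ℝ≥0) : ℝ) ^ 2 * max (1 / δ) (1 / ρ) ^ 2)
    (B := 2 * ((L + 1 : ℝ≥0) : ℝ) * max (1 / δ) (1 / ρ) ^ 2 * σ ^ 2) Δ hc hβ ha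
    (by positivity) (by positivity)
  refine ⟨C, hC, ?_⟩
  intro n d k l A D _ Ω _ μ _ X flow hkl _ hbatch hdamp hstep hese hF hd hd' _ hX hXD hind hsmooth
    hlow hΔ hnoise hhess hprec
  have h : A.IsRun (L + 1) σ z δ ρ flow D μ X :=
    { damping_pos := hδ
      prec_pos := hρ
      smooth_pos := by positivity
      rank_le := hkl
      batchSize_pos := hbatch
      damping_eq := hdamp
      stepSize_nonneg := fun t => by rw [hstep]; positivity
      eseBatch_lt := hese
      measurable_loss := hF
      differentiable_loss := hd
      differentiable_gradient_loss := hd'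
      measurable_sample := hX
      map_sample := hXD
      indep_sample := hind
      smooth := hsmooth.mono (by simp)
      low_le := hlow
      noise := hnoise
      hessian_le := hhess
      prec_bounds := hprec }
  refine ⟨fun t => h.integrable_norm_gradient_sq (h.integrable_objective t), ?_⟩
  refine hmain
    (fun t => ∫ ω, A.objective D (A.iterate (fun s i => X s i ω) t) ∂μ - flow)
    (fun t => ∫ ω, ‖gradient (A.objective D) (A.iterate (fun s i => X s i ω) t)‖ ^ 2 ∂μ)
    A.stepSize (fun t => ?_) (fun t => integral_nonneg fun ω => by positivity) ?_ hstep
    h.gap_succ_le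
  · have := integral_mono (integrable_const flow) (h.integrable_objective t) fun ω => hlow _
    simpa using this
  · simpa [FOSI.iterate, FOSI.state] using hΔ
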